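/- Let $t_0<T$, let $(\Omega,\mathcal F,\mathbb P)$ be a probability space, let $a,b\in \mathrm L^2([t_0,T]\times\Omega)$ be stochastic processes and $x_0\in\mathrm L^2(\Omega)$ a random variable. Let $\mu_a(t)=\mathbb E[a(t)]$, $\mu_b(t)=\mathbb E[b(t)]$, and consider Karhunen–Loève expansions $$a(t,\omega)=\mu_a(t)+\sum_{j}\sqrt{\nu_j}\,\phi_j(t)\,\xi_j(\omega),\qquad b(t,\omega)=\mu_b(t)+\sum_{i}\sqrt{\gamma_i}\,\psi_i(t)\,\eta_i(\omega),$$ with indices $1\le j\le J_a$, $1\le i\le J_b$, where $0\le J_a\le\infty$ and $1\le J_b\le\infty$. Here $(\nu_j,\phi_j)$ are eigenpairs (in any order) with $\nu_j\ge 0$ of the covariance operator $f\mapsto\int_{t_0}^T\mathrm{Cov}[a(\cdot),a(s)]f(s)\,\mathrm ds$ on $\mathrm L^2([t_0,T])$; the $\phi_j$ are orthonormal and the operator vanishes on their orthogonal complement (so either they form an orthonormal basis of eigenfunctions, or eigenfunctions of eigenvalue $0$ have been left out); the $\xi_j$ are centred, of unit variance, pairwise uncorrelated, and $\sqrt{\nu_j}\,\xi_j=\int_{t_0}^T(a(s)-\mu_a(s))\phi_j(s)\,\mathrm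 ds$ a.s. The same holds for $b$ with $(\gamma_i,\psi_i,\eta_i)$, and $\gamma_1>0$. Let $$x(t,\omega)=x_0(\omega)\,\mathrm e^{\int_{t_0}^t a(s,\omega)\,\mathrm ds}+\int_{t_0}^t b(s,\omega)\,\mathrm e^{\int_s^t a(r,\omega)\,\mathrm dr}\,\mathrm ds$$ be the solution of $x'(t)=a(t)x(t)+b(t)$, $x(t_0)=x_0$. For $N\ge1$ put $\pmb\xi_N=(\xi_1,\dots,\xi_N)$ and $\pmb\eta_N=(\eta_1,\dots,\eta_N)$ (vectors and sums stop at $J_a$, resp. $J_b$, if this is smaller than $N$), and $$K_a(t,\pmb\xi_N)=\int_{t_0}^t\Big(\mu_a(s)+\sum_{j=1}^N\sqrt{\nu_j}\,\phi_j(s)\xi_j\Big)\mathrm ds,\qquad S_b(s,\pmb\eta_N)=\mu_b(s)+\sum_{i=1}^N\sqrt{\gamma_i}\,\psi_i(s)\eta_i .$$ Assume: - for every $N\ge1$, the random vectors $x_0$, $\eta_1$ and $(\xi_1,\dots,\xi_N,\eta_2,\dots,\eta_N)$ are absolutely continuous, with densities $f_0$, $f_{\eta_1}$, $f_{(\xi_1,\dots,\xi_N,\eta_2,\dots,\eta_N)}$,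 and mutually independent; - $f_{\eta_1}$ is Lipschitz on $\mathbb R$; - there is $A>0$ such that every $\xi_j$ takes its values in $[-A,A]$ almost surely, and $\psi_1>0$ on $(t_0,T)$. For $t\in(t_0,T]$, $x\in\mathbb R$, $N\ge1$, and with $\mathcal D_N=\mathbb R\times[-A,A]^N\times\mathbb R^{N-1}$, let $$\begin{aligned} f_1^N(x,t)=\int_{\mathcal D_N}& f_{\eta_1}\!\left(\frac{x\,\mathrm e^{-K_a(t,\pmb\xi_N)}-x_0-\int_{t_0}^t\big(\mu_b(s)+\sum_{i=2}^N\sqrt{\gamma_i}\,\psi_i(s)\eta_i\big)\mathrm e^{-K_a(s,\pmb\xi_N)}\,\mathrm ds}{\sqrt{\gamma_1}\int_{t_0}^t\psi_1(s)\,\mathrm e^{-K_a(s,\pmb\xi_N)}\,\mathrm ds}\right) f_0(x_0)\\ &\cdot f_{(\xi_1,\dots,\xi_N,\eta_2,\dots,\eta_N)}(\xi_1,\dots,\xi_N,\eta_2,\dots,\eta_N)\,\frac{\mathrm e^{-K_a(t,\pmb\xi_N)}}{\sqrt{\gamma_1}\int_{t_0}^t\psi_1(s)\,\mathrm e^{-K_a(s,\pmb\xi_N)}\,\mathrm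 ds}\;\mathrm dx_0\,\mathrm d\xi_1\cdots\mathrm d\xi_N\,\mathrm d\eta_2\cdots\mathrm d\eta_N . \end{aligned}$$ Then, for each fixed $t\in(t_0,T]$: 1. For every $N\ge1$, $f_1^N(\cdot,t)$ is a density of the truncated solution $$x_{N,N}(t)=x_0\,\mathrm e^{K_a(t,\pmb\xi_N)}+\int_{t_0}^tS_b(s,\pmb\eta_N)\,\mathrm e^{K_a(t,\pmb\xi_N)-K_a(s,\pmb\xi_N)}\,\mathrm ds,$$ and, for every $x\in\mathbb R$ and every density $f_{\pmb\xi_N,\pmb\eta_N}$ of $(\pmb\xi_N,\pmb\eta_N)$, $$f_1^N(x,t)=\int_{\mathbb R^{2N}}f_0\Big(x\,\mathrm e^{-K_a(t,\pmb\xi_N)}-\int_{t_0}^tS_b(s,\pmb\eta_N)\,\mathrm e^{-K_a(s,\pmb\xi_N)}\,\mathrm ds\Big)f_{\pmb\xi_N,\pmb\eta_N}(\pmb\xi_N,\pmb\eta_N)\,\mathrm e^{-K_a(t,\pmb\xi_N)}\,\mathrm d\pmb\xi_N\,\mathrm d\pmb\eta_N .$$ 2. There is a density $f_1(\cdot,t)$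 of $x(t,\cdot)$ such that, for every bounded set $J\subseteq\mathbb R$, the functions $f_1^N(\cdot,t)$ and $f_1(\cdot,t)$ belong to $\mathrm L^\infty(J)$ and $f_1^N(\cdot,t)\to f_1(\cdot,t)$ in $\mathrm L^\infty(J)$ as $N\to\infty$. -/

import Mathlib

open MeasureTheory ProbabilityTheory Filter Topology
open scoped ENNReal

noncomputable section

/-- `f` is a (version of the) probability density function of the random vector `X` under `P`,
with respect to Lebesgue measure: a nonnegative measurable function such that the law of `X` is
`f(x) dx`. -/
structure IsDensity {Ω E : Type*} [MeasurableSpace Ω] [MeasureSpace E] (P : Measure Ω)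
    (X : Ω → E) (f : E → ℝ) : Prop where
  aemeasurable : AEMeasurable X P
  measurable : Measurable f
  nonneg : ∀ x, 0 ≤ f x
  map_eq : P.map X = volume.withDensity (fun x => ENNReal.ofReal (f x))

/-- The mean function `μ(t) = E[X(t)]` of a stochastic process. -/
def meanFun {Ω : Type*} [MeasurableSpace Ω] (P : Measure Ω) (X : ℝ → Ω → ℝ) (t : ℝ) : ℝ :=
  ∫ ω, X t ω ∂P

/-- The covariance operator `(C f)(t) = ∫_{[t₀,T]} Cov[X(t), X(s)] f(s) ds`. -/
def covOperator {Ω : Type*} [MeasurableSpace Ω] (P : Measure Ω) (t₀ T : ℝ) (X : ℝ → Ω → ℝ)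
    (f : ℝ → ℝ) (t : ℝ) : ℝ :=
  ∫ s in t₀..T, covariance (X t) (X s) P * f s

/-- Karhunen-Loève data of a square integrable process `X` on `[t₀,T]`. There are `J ≤ ∞` terms,
indexed by the natural numbers `j < J` (values at indices `j ≥ J` play no role). The pairs
`(ν j, φ j)` are eigenpairs of the covariance operator, the `φ j` are orthonormal in
`L²([t₀,T])`, and they exhaust the range of the covariance operator, which vanishes on their
orthogonal complement. (Two cases are thus included: `J = ∞` with `φ` an orthonormal basis of
`L²([t₀,T])` consisting of eigenfunctions, and the system of eigenfunctions of the nonzero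
eigenvalues only, finite or not.) The `ξ j` are centred, of unit variance, pairwise
uncorrelated, and `√(ν j) ξ j` is the coefficient of the centred process along `φ j`. -/
structure IsKarhunenLoeve {Ω : Type*} [MeasurableSpace Ω] (P : Measure Ω) (t₀ T : ℝ)
    (X : ℝ → Ω → ℝ) (J : ℕ∞) (ν : ℕ → ℝ) (φ : ℕ → ℝ → ℝ) (ξ : ℕ → Ω → ℝ) : Prop where
  eigenvalue_nonneg : ∀ j : ℕ, (j : ℕ∞) < J → 0 ≤ ν j
  eigenfunction_memLp : ∀ j : ℕ, (j : ℕ∞) < J → MemLp (φ j) 2 (volume.restrict (Set.Icc t₀ T))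
  orthonormal : ∀ i j : ℕ, (i : ℕ∞) < J → (j : ℕ∞) < J →
    ∫ s in t₀..T, φ i s * φ j s = if i = j then 1 else 0
  eigen : ∀ j : ℕ, (j : ℕ∞) < J → ∀ᵐ t ∂(volume.restrict (Set.Icc t₀ T)),
    covOperator P t₀ T X (φ j) t = ν j * φ j t
  exhaustive : ∀ f : ℝ → ℝ, MemLp f 2 (volume.restrict (Set.Icc t₀ T)) →
    (∀ j : ℕ, (j : ℕ∞) < J → ∫ s in t₀..T, f s * φ j s = 0) →
    ∀ᵐ t ∂(volume.restrict (Set.Icc t₀ T)), covOperator P t₀ T X f t = 0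
  coeff_memLp : ∀ j : ℕ, (j : ℕ∞) < J → MemLp (ξ j) 2 P
  coeff_mean : ∀ j : ℕ, (j : ℕ∞) < J → ∫ ω, ξ j ω ∂P = 0
  coeff_variance : ∀ j : ℕ, (j : ℕ∞) < J → variance (ξ j) P = 1
  coeff_uncorrelated : ∀ i j : ℕ, (i : ℕ∞) < J → (j : ℕ∞) < J → i ≠ j →
    covariance (ξ i) (ξ j) P = 0
  coeff_eq : ∀ j : ℕ, (j : ℕ∞) < J → ∀ᵐ ω ∂P,
    Real.sqrt (ν j) * ξ j ω = ∫ s in t₀..T, (X s ω - meanFun P X s) * φ j s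

/-- The number `min N J` of terms in the truncation of order `N` of an expansion with `J ≤ ∞`
terms. -/
def truncLen (J : ℕ∞) (N : ℕ) : ℕ := (min (N : ℕ∞) J).toNat

/-- `μ(s) + ∑_{j < n} √(ν j) φ_j(s) y_j`, for a real vector `y` of length `n`. -/
def partialSum (μ : ℝ → ℝ) (ν : ℕ → ℝ) (φ : ℕ → ℝ → ℝ) {n : ℕ} (y : Fin n → ℝ) (s : ℝ) : ℝ :=
  μ s + ∑ j : Fin n, Real.sqrt (ν j) * φ j s * y j

/-- `K(t, y) = ∫_{t₀}^t (μ(s) + ∑_{j < n} √(ν j) φ_j(s) y_j) ds`. -/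
def intPartialSum (t₀ : ℝ) (μ : ℝ → ℝ) (ν : ℕ → ℝ) (φ : ℕ → ℝ → ℝ) {n : ℕ} (y : Fin n → ℝ)
    (t : ℝ) : ℝ :=
  ∫ s in t₀..t, partialSum μ ν φ y s

/-- The solution formula
`x₀ exp(∫_{t₀}^t a) + ∫_{t₀}^t b(s) exp(∫_s^t a) ds` of `x' = a x + b`, `x(t₀) = x₀`. -/
def linearSolution (t₀ x₀ : ℝ) (a b : ℝ → ℝ) (t : ℝ) : ℝ :=
  x₀ * Real.exp (∫ s in t₀..t, a s) + ∫ s in t₀..t, b s * Real.exp (∫ r in s..t, a r)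

/-- The first `n` entries of a sequence of random variables, as a random vector. -/
def firstVec {Ω : Type*} (ξ : ℕ → Ω → ℝ) (n : ℕ) (ω : Ω) : Fin n → ℝ := fun j => ξ j ω

/-- The sequence with its entry of index `0` removed. -/
def dropFirst {α : Type*} (u : ℕ → α) (i : ℕ) : α := u (i + 1)

/-- The approximating density obtained by isolating the first random coefficient of `b`. Here
`n` and `m` are the numbers of random coefficients of `a` and of `b` that are kept; the
variables of integration are `p.1` (the value of `x₀`), `p.2.1` (the `n` coefficients of `a`,
in `[-A,A]ⁿ`) and `p.2.2` (the coefficients of `b` but the first one); `f₀`, `fη` and `fv` are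
the densities of `x₀`, of the first coefficient of `b`, and of the vector of all others. -/
def densityIsolatingEta (t₀ A : ℝ) (μa μb : ℝ → ℝ) (ν γ : ℕ → ℝ) (φ ψ : ℕ → ℝ → ℝ) (n m : ℕ)
    (f₀ fη : ℝ → ℝ) (fv : (Fin n → ℝ) × (Fin (m - 1) → ℝ) → ℝ) (t x : ℝ) : ℝ :=
  ∫ p : ℝ × (Fin n → ℝ) × (Fin (m - 1) → ℝ) in
      Set.univ ×ˢ ((Set.univ.pi fun _ => Set.Icc (-A) A) ×ˢ Set.univ),
    fη ((x * Real.exp (-intPartialSum t₀ μa ν φ p.2.1 t) - p.1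
          - ∫ s in t₀..t, partialSum μb (dropFirst γ) (dropFirst ψ) p.2.2 s
              * Real.exp (-intPartialSum t₀ μa ν φ p.2.1 s))
        / (Real.sqrt (γ 0)
            * ∫ s in t₀..t, ψ 0 s * Real.exp (-intPartialSum t₀ μa ν φ p.2.1 s)))
      * f₀ p.1 * fv p.2
      * (Real.exp (-intPartialSum t₀ μa ν φ p.2.1 t)
        / (Real.sqrt (γ 0)
            * ∫ s in t₀..t, ψ 0 s * Real.exp (-intPartialSum t₀ μa ν φ p.2.1 s)))

/-- The expression of the approximating density obtained by isolating `x₀`; `g` is the joint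
density of the first `n` random coefficients of `a` and the first `m` ones of `b`. -/
def densityIsolatingInit (t₀ : ℝ) (μa μb : ℝ → ℝ) (ν γ : ℕ → ℝ) (φ ψ : ℕ → ℝ → ℝ) (n m : ℕ)
    (f₀ : ℝ → ℝ) (g : (Fin n → ℝ) × (Fin m → ℝ) → ℝ) (t x : ℝ) : ℝ :=
  ∫ p : (Fin n → ℝ) × (Fin m → ℝ),
    f₀ (x * Real.exp (-intPartialSum t₀ μa ν φ p.1 t)
        - ∫ s in t₀..t, partialSum μb γ ψ p.2 s
            * Real.exp (-intPartialSum t₀ μa ν φ p.1 s))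
      * g p * Real.exp (-intPartialSum t₀ μa ν φ p.1 t)

end

/-!
Multiplying the truncated solution by `exp(-K_N(t))`, with `K_N = K_a(·, ξ_N)`, gives
`x₀ + c_N η_0 + R_N`, where `c_N = √(γ 0) ∫ ψ_0 exp(-K_N)` is positive and `R_N` collects the mean
and the other random coefficients of `b`. Given all variables but `η_0`, the truncated solution is
thus an affine function of `η_0`, so that it has the density
`x ↦ E[fη((x exp(-K_N(t)) - x₀ - R_N) / c_N) exp(-K_N(t)) / c_N]`
(`IsDensity.affine_of_indep`), which is `densityIsolatingEta` written as an expectation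
(`IntegrableCoeffs.densityIsolatingEta_eq_integral`). The formula isolating `x₀` is the same
convolution with the roles of `x₀` and `c_N η_0` exchanged (`IsDensity.lintegral_convolution_comm`).

For the limit, no rate is needed. The covariance operator vanishes on the functions orthogonal to
the eigenfunctions, so almost every path of `a` and of `b` has a Karhunen-Loève expansion that
converges in `L²([t₀, T])` (`IsKarhunenLoeve.ae_tendsto_partialSum`); hence `K_N`, `c_N` and `R_N`
converge almost surely. As the `ξ j` are bounded by `A`, Bessel's inequality and the finiteness of
the trace of the covariance operator bound `K_N` independently of `N`
(`IsKarhunenLoeve.exists_bound_intPartialSum`), and with it the factor `exp(-K_N(t)) / c_N`. The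
density `fη` being Lipschitz, hence bounded, the densities of the truncated solutions converge
pointwise by dominated convergence and are equi-Lipschitz, so they converge uniformly on bounded
sets. Testing against compactly supported continuous functions shows that the limit is a density
of the almost sure limit of the truncated solutions (`isDensity_of_tendsto`), which is `x(t)`.
-/

/-! ### Densities, independence and affine changes of variable -/

theorem lintegral_eq_ofReal_abs_mul_lintegral_affine {c : ℝ} (hc : c ≠ 0) (d : ℝ) {F : ℝ → ℝ≥0∞}
    (hF : Measurable F) :
    ∫⁻ x, F x = ENNReal.ofReal |c| * ∫⁻ y, F (c * y + d) := by
  have h1 : ∫⁻ y, F (c * y + d) = ENNReal.ofReal |c⁻¹| * ∫⁻ x, F x := by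
    have : ∫⁻ y, F (c * y + d) = ∫⁻ z, F (z + d) ∂(Measure.map (c * ·) volume) := by
      rw [lintegral_map (by fun_prop) (by fun_prop)]
    rw [this, Real.map_volume_mul_left hc, lintegral_smul_measure, lintegral_add_right_eq_self,
      smul_eq_mul]
  rw [h1, ← mul_assoc, ← ENNReal.ofReal_mul (abs_nonneg c), ← abs_mul, mul_inv_cancel₀ hc]
  simp

theorem IsDensity.lintegral_comp {Ω E : Type*} [MeasurableSpace Ω] [MeasureSpace E]
    {P : Measure Ω} {X : Ω → E} {f : E → ℝ} (h : IsDensity P X f) {G : E → ℝ≥0∞}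
    (hG : Measurable G) :
    ∫⁻ ω, G (X ω) ∂P = ∫⁻ x, ENNReal.ofReal (f x) * G x := by
  rw [← lintegral_map' hG.aemeasurable h.aemeasurable, h.map_eq,
    lintegral_withDensity_eq_lintegral_mul _ h.measurable.ennreal_ofReal hG]
  rfl

theorem IsDensity.integral_comp {Ω E : Type*} [MeasurableSpace Ω] [MeasureSpace E]
    {P : Measure Ω} {X : Ω → E} {f : E → ℝ} (h : IsDensity P X f) {G : E → ℝ}
    (hG : Measurable G) :
    ∫ ω, G (X ω) ∂P = ∫ x, G x * f x := by
  rw [← integral_map h.aemeasurable hG.aestronglyMeasurable, h.map_eq,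
    integral_withDensity_eq_integral_toReal_smul h.measurable.ennreal_ofReal (by simp)]
  refine integral_congr_ae (.of_forall fun x => ?_)
  simp [ENNReal.toReal_ofReal (h.nonneg x), mul_comm]

theorem IsDensity.lintegral_eq_one {Ω E : Type*} [MeasurableSpace Ω] [MeasureSpace E]
    {P : Measure Ω} [IsProbabilityMeasure P] {X : Ω → E} {f : E → ℝ} (h : IsDensity P X f) :
    ∫⁻ x, ENNReal.ofReal (f x) = 1 := by
  simpa using (h.lintegral_comp (G := fun _ => 1) measurable_const).symm

/-- The joint density of two independent random vectors is the product of their densities. -/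
theorem IsDensity.prodMk {Ω E F : Type*} [MeasurableSpace Ω] [MeasureSpace E] [MeasureSpace F]
    [SFinite (volume : Measure F)] [SFinite (volume : Measure E)] {P : Measure Ω}
    [IsFiniteMeasure P] {X : Ω → E} {Y : Ω → F} {f : E → ℝ} {g : F → ℝ} (hX : IsDensity P X f)
    (hY : IsDensity P Y g) (hXY : IndepFun X Y P) :
    IsDensity P (fun ω => (X ω, Y ω)) (fun p => f p.1 * g p.2) where
  aemeasurable := hX.aemeasurable.prodMk hY.aemeasurable
  measurable := (hX.measurable.comp measurable_fst).mul (hY.measurable.comp measurable_snd)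
  nonneg p := mul_nonneg (hX.nonneg _) (hY.nonneg _)
  map_eq := by
    rw [(indepFun_iff_map_prod_eq_prod_map_map hX.aemeasurable hY.aemeasurable).1 hXY, hX.map_eq,
      hY.map_eq, prod_withDensity hX.measurable.ennreal_ofReal hY.measurable.ennreal_ofReal]
    simp_rw [← ENNReal.ofReal_mul (hX.nonneg _)]
    rfl

/-- The law of `(X, Y, Z)` is the product of the three laws, so the order in which the variables are
split off does not matter. -/
theorem ProbabilityTheory.IndepFun.prodMk_left_comm {Ω E F G : Type*} [MeasurableSpace Ω]
    [MeasurableSpace E] [MeasurableSpace F] [MeasurableSpace G] {P : Measure Ω}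
    [IsProbabilityMeasure P] {X : Ω → E} {Y : Ω → F} {Z : Ω → G} (hX : AEMeasurable X P)
    (hY : AEMeasurable Y P) (hZ : AEMeasurable Z P) (h₁ : IndepFun X (fun ω => (Y ω, Z ω)) P)
    (h₂ : IndepFun Y Z P) : IndepFun Y (fun ω => (X ω, Z ω)) P := by
  have hXZ : IndepFun X Z P := h₁.comp measurable_id measurable_snd
  have := Measure.isProbabilityMeasure_map hX
  have := Measure.isProbabilityMeasure_map hY
  have := Measure.isProbabilityMeasure_map hZ
  rw [indepFun_iff_map_prod_eq_prod_map_map hY (hX.prodMk hZ),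
    (indepFun_iff_map_prod_eq_prod_map_map hX hZ).1 hXZ]
  refine Measure.ext_of_lintegral _ fun f hf => ?_
  have e : ∫⁻ q, f q ∂(P.map fun ω => (Y ω, X ω, Z ω))
      = ∫⁻ q, f (q.2.1, q.1, q.2.2) ∂(P.map fun ω => (X ω, Y ω, Z ω)) := by
    rw [lintegral_map' hf.aemeasurable (hY.prodMk (hX.prodMk hZ)),
      lintegral_map' (by fun_prop) (hX.prodMk (hY.prodMk hZ))]
  rw [e, (indepFun_iff_map_prod_eq_prod_map_map hX (hY.prodMk hZ)).1 h₁,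
    (indepFun_iff_map_prod_eq_prod_map_map hY hZ).1 h₂, lintegral_prod _ (by fun_prop),
    lintegral_prod _ (by fun_prop)]
  have l : ∀ x, ∫⁻ q, f (q.1, x, q.2) ∂((P.map Y).prod (P.map Z))
      = ∫⁻ y, ∫⁻ z, f (y, x, z) ∂(P.map Z) ∂(P.map Y) :=
    fun x => lintegral_prod _ (by fun_prop)
  have r : ∀ y, ∫⁻ q, f (y, q) ∂((P.map X).prod (P.map Z))
      = ∫⁻ x, ∫⁻ z, f (y, x, z) ∂(P.map Z) ∂(P.map X) :=
    fun y => lintegral_prod _ (by fun_prop)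
  simp_rw [l, r]
  refine lintegral_lintegral_swap ?_
  refine Measurable.aemeasurable ?_
  exact Measurable.lintegral_prod_right' (f := fun q : (E × F) × G => f (q.1.2, q.1.1, q.2))
    (by fun_prop)

theorem IsDensity.lintegral_comp_indep {Ω E : Type*} [MeasurableSpace Ω] [MeasurableSpace E]
    {P : Measure Ω} [IsProbabilityMeasure P] {U : Ω → E} {V : Ω → ℝ} {f : ℝ → ℝ}
    (hU : AEMeasurable U P) (hV : IsDensity P V f) (hUV : IndepFun V U P)
    {F : E × ℝ → ℝ≥0∞} (hF : Measurable F) :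
    ∫⁻ ω, F (U ω, V ω) ∂P = ∫⁻ ω, (∫⁻ v, ENNReal.ofReal (f v) * F (U ω, v)) ∂P := by
  have := Measure.isProbabilityMeasure_map hU
  have := Measure.isProbabilityMeasure_map hV.aemeasurable
  have hm : Measurable fun u => ∫⁻ v, ENNReal.ofReal (f v) * F (u, v) :=
    Measurable.lintegral_prod_right'
      (f := fun q : E × ℝ => ENNReal.ofReal (f q.2) * F q)
      ((hV.measurable.comp measurable_snd).ennreal_ofReal.mul hF)
  rw [← lintegral_map' hF.aemeasurable (hU.prodMk hV.aemeasurable),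
    (indepFun_iff_map_prod_eq_prod_map_map hU hV.aemeasurable).1 hUV.symm,
    lintegral_prod _ hF.aemeasurable, ← lintegral_map' hm.aemeasurable hU]
  refine lintegral_congr fun u => ?_
  rw [hV.map_eq, lintegral_withDensity_eq_lintegral_mul _ hV.measurable.ennreal_ofReal
    (by fun_prop)]
  rfl

/-- If `V` has density `f` and is independent of `U`, then `c(U) V + d(U)` with `c > 0` has the
density `x ↦ E[f((x - d(U)) / c(U)) / c(U)]`: given `U`, it is an affine function of `V`.
The bound `M` makes that expectation finite at every `x`. -/
theorem IsDensity.affine_of_indep {Ω E : Type*} [MeasurableSpace Ω] [MeasurableSpace E]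
    {P : Measure Ω} [IsProbabilityMeasure P] {U : Ω → E} {V : Ω → ℝ} {f : ℝ → ℝ}
    (hU : AEMeasurable U P) (hV : IsDensity P V f) (hUV : IndepFun V U P)
    {c d : E → ℝ} (hc : Measurable c) (hd : Measurable d) (hc0 : ∀ u, 0 < c u) {M : ℝ}
    (hM : ∀ᵐ ω ∂P, ∀ y, f y / c (U ω) ≤ M) :
    IsDensity P (fun ω => c (U ω) * V ω + d (U ω))
      (fun x => ∫ ω, f ((x - d (U ω)) / c (U ω)) / c (U ω) ∂P) := by
  have hfm := hV.measurable
  have hjoint : Measurable fun q : ℝ × E => f ((q.1 - d q.2) / c q.2) / c q.2 := by fun_prop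
  have hmap : ∀ x, ∫ ω, f ((x - d (U ω)) / c (U ω)) / c (U ω) ∂P
      = ∫ u, f ((x - d u) / c u) / c u ∂(P.map U) := fun x => by
    rw [integral_map hU]
    exact (Measurable.of_uncurry_left (f := fun x u => f ((x - d u) / c u) / c u)
      hjoint).aestronglyMeasurable
  have hnn : ∀ (x : ℝ) (u : E), 0 ≤ f ((x - d u) / c u) / c u := fun x u =>
    div_nonneg (hV.nonneg _) (hc0 u).le
  have := Measure.isProbabilityMeasure_map hU
  have hm : AEMeasurable (fun ω => c (U ω) * V ω + d (U ω)) P :=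
    ((hc.comp_aemeasurable hU).mul hV.aemeasurable).add (hd.comp_aemeasurable hU)
  refine ⟨?_, ?_, fun x => integral_nonneg fun ω => hnn x _, ?_⟩
  · exact hm
  · simp_rw [hmap]
    exact (hjoint.stronglyMeasurable.integral_prod_right (ν := P.map U)).measurable
  · have hof : ∀ x, ENNReal.ofReal (∫ ω, f ((x - d (U ω)) / c (U ω)) / c (U ω) ∂P)
        = ∫⁻ ω, ENNReal.ofReal (f ((x - d (U ω)) / c (U ω)) / c (U ω)) ∂P := fun x => by
      refine ofReal_integral_eq_lintegral_ofReal ?_ (.of_forall fun ω => hnn x _)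
      refine Integrable.of_bound ?_ M ?_
      · exact (Measurable.comp_aemeasurable (g := fun u => f ((x - d u) / c u) / c u)
          (by fun_prop) hU).aestronglyMeasurable
      · filter_upwards [hM] with ω hω
        rw [Real.norm_of_nonneg (hnn x _)]
        exact hω _
    refine Measure.ext_of_lintegral _ fun g hg => ?_
    rw [lintegral_map' hg.aemeasurable hm]
    rw [lintegral_withDensity_eq_lintegral_mul _ _ hg]
    swap
    · simp_rw [hmap]
      exact (hjoint.stronglyMeasurable.integral_prod_right (ν := P.map U)).measurable.ennreal_ofReal
    have key := hV.lintegral_comp_indep hU hUV (F := fun q => g (c q.1 * q.2 + d q.1))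
      (by fun_prop)
    simp only at key
    rw [key]
    simp only [Pi.mul_apply, hof]
    have h1 : ∀ u : E, ∫⁻ v, ENNReal.ofReal (f v) * g (c u * v + d u)
        = ∫⁻ x, ENNReal.ofReal (f ((x - d u) / c u) / c u) * g x := fun u => by
      rw [lintegral_eq_ofReal_abs_mul_lintegral_affine (hc0 u).ne' (d u)
        (F := fun x => ENNReal.ofReal (f ((x - d u) / c u) / c u) * g x) (by fun_prop),
        ← lintegral_const_mul _ (by fun_prop)]
      refine lintegral_congr fun v => ?_
      rw [← mul_assoc, ← ENNReal.ofReal_mul (abs_nonneg _), abs_of_pos (hc0 u),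
        mul_div_cancel₀ _ (hc0 u).ne', add_sub_cancel_right, mul_div_cancel_left₀ _ (hc0 u).ne']
    simp_rw [h1]
    have h2 : ∀ x, ∫⁻ ω, ENNReal.ofReal (f ((x - d (U ω)) / c (U ω)) / c (U ω)) ∂P
        = ∫⁻ u, ENNReal.ofReal (f ((x - d u) / c u) / c u) ∂(P.map U) := fun x => by
      rw [lintegral_map' (by fun_prop) hU]
    rw [← lintegral_map' (f := fun u => ∫⁻ x, ENNReal.ofReal (f ((x - d u) / c u) / c u) * g x)
      (Measurable.lintegral_prod_right' (f := fun q : E × ℝ =>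
        ENNReal.ofReal (f ((q.2 - d q.1) / c q.1) / c q.1) * g q.2) (by fun_prop)).aemeasurable hU,
      lintegral_lintegral_swap (by fun_prop)]
    refine lintegral_congr fun x => ?_
    rw [lintegral_mul_const _ (by fun_prop), h2]

/-- Two ways to condition in the convolution of `X` and `s(W) Y`, for `X` and `Y` with densities
`f` and `g` and both independent of `W`. -/
theorem IsDensity.lintegral_convolution_comm {Ω E : Type*} [MeasurableSpace Ω] [MeasurableSpace E]
    {P : Measure Ω} [IsProbabilityMeasure P] {X Y : Ω → ℝ} {W : Ω → E} {f g : ℝ → ℝ}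
    (hX : IsDensity P X f) (hY : IsDensity P Y g) (hW : AEMeasurable W P)
    (hXW : IndepFun X W P) (hYW : IndepFun Y W P) {q s h : E → ℝ} (hq : Measurable q)
    (hs : Measurable s) (hh : Measurable h) (hs0 : ∀ w, 0 < s w) :
    ∫⁻ ω, ENNReal.ofReal (g ((q (W ω) - X ω) / s (W ω)) * (h (W ω) / s (W ω))) ∂P
      = ∫⁻ ω, ENNReal.ofReal (f (q (W ω) - s (W ω) * Y ω) * h (W ω)) ∂P := by
  have hf := hX.measurable
  have hg := hY.measurable
  have e1 := hX.lintegral_comp_indep hW hXW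
    (F := fun p => ENNReal.ofReal (g ((q p.1 - p.2) / s p.1) * (h p.1 / s p.1))) (by fun_prop)
  have e2 := hY.lintegral_comp_indep hW hYW
    (F := fun p => ENNReal.ofReal (f (q p.1 - s p.1 * p.2) * h p.1)) (by fun_prop)
  simp only at e1 e2
  rw [e1, e2]
  refine lintegral_congr fun ω => ?_
  generalize W ω = w
  have hs' := hs0 w
  rw [lintegral_eq_ofReal_abs_mul_lintegral_affine (neg_ne_zero.2 hs'.ne') (q w) (by fun_prop),
    ← lintegral_const_mul _ (by fun_prop)]
  refine lintegral_congr fun y => ?_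
  rw [← ENNReal.ofReal_mul (hX.nonneg _), ← ENNReal.ofReal_mul (abs_nonneg _),
    ← ENNReal.ofReal_mul (hY.nonneg _), abs_neg, abs_of_pos hs']
  have : (q w - (-s w * y + q w)) / s w = y := by field_simp; ring
  rw [this, show -s w * y + q w = q w - s w * y by ring]
  congr 1
  field_simp

/-- A Lipschitz probability density is bounded, as a high peak has to be a wide one. -/
theorem exists_bound_of_lipschitzWith_density {f : ℝ → ℝ} {L : NNReal} (hL : LipschitzWith L f)
    (h1 : ∫⁻ x, ENNReal.ofReal (f x) ≤ 1) : ∃ B, ∀ x, f x ≤ B := by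
  refine ⟨2 * (L + 1), fun x => ?_⟩
  by_contra! hx
  have hle : ∀ y ∈ Set.Icc x (x + 1), (L + 2 : ℝ) ≤ f y := fun y hy => by
    have := hL.dist_le_mul x y
    rw [Real.dist_eq, Real.dist_eq, abs_sub_comm x y,
      abs_of_nonneg (a := y - x) (by linarith [hy.1])] at this
    have h2 := (abs_le.1 this).2
    nlinarith [L.coe_nonneg, hy.2]
  have hint : ENNReal.ofReal (L + 2 : ℝ) ≤ 1 := by
    calc ENNReal.ofReal (L + 2 : ℝ)
        = ∫⁻ _ in Set.Icc x (x + 1), ENNReal.ofReal (L + 2 : ℝ) := by simp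
      _ ≤ ∫⁻ y in Set.Icc x (x + 1), ENNReal.ofReal (f y) :=
        setLIntegral_mono' measurableSet_Icc fun y hy => ENNReal.ofReal_le_ofReal (hle y hy)
      _ ≤ 1 := (setLIntegral_le_lintegral _ _).trans h1
  rw [ENNReal.ofReal_le_one] at hint
  linarith [L.coe_nonneg]

/-! ### Square integrable functions and processes -/

theorem inner_toLp_toLp {α : Type*} [MeasurableSpace α] {m : Measure α} {f g : α → ℝ}
    (hf : MemLp f 2 m) (hg : MemLp g 2 m) :
    inner ℝ (hf.toLp f) (hg.toLp g) = ∫ s, f s * g s ∂m := by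
  rw [L2.inner_def]
  refine integral_congr_ae ?_
  filter_upwards [hf.coeFn_toLp, hg.coeFn_toLp] with s h1 h2
  simp [h1, h2, mul_comm]

theorem norm_toLp_sq {α : Type*} [MeasurableSpace α] {m : Measure α} {f : α → ℝ}
    (hf : MemLp f 2 m) : ‖hf.toLp f‖ ^ 2 = ∫ s, f s ^ 2 ∂m := by
  rw [← real_inner_self_eq_norm_sq, inner_toLp_toLp]
  simp [sq]

theorem sq_integral_mul_le {α : Type*} [MeasurableSpace α] {m : Measure α} {f g : α → ℝ}
    (hf : MemLp f 2 m) (hg : MemLp g 2 m) :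
    (∫ s, f s * g s ∂m) ^ 2 ≤ (∫ s, f s ^ 2 ∂m) * ∫ s, g s ^ 2 ∂m := by
  rw [← inner_toLp_toLp hf hg, ← norm_toLp_sq hf, ← norm_toLp_sq hg, ← mul_pow]
  exact sq_le_sq' (neg_le_of_abs_le (abs_real_inner_le_norm _ _)) (real_inner_le_norm _ _)

/-- Sections of a square integrable function on a product are square integrable. -/
theorem MeasureTheory.MemLp.ae_section_left {α β : Type*} [MeasurableSpace α] [MeasurableSpace β]
    {m : Measure α} {P : Measure β} [SFinite m] [SFinite P] {X : α → β → ℝ}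
    (hX : MemLp (Function.uncurry X) 2 (m.prod P)) : ∀ᵐ s ∂m, MemLp (X s) 2 P := by
  filter_upwards [hX.1.prodMk_left, hX.integrable_sq.prod_right_ae] with s h1 h2
  exact (memLp_two_iff_integrable_sq h1).2 h2

theorem MeasureTheory.MemLp.ae_section_right {α β : Type*} [MeasurableSpace α] [MeasurableSpace β]
    {m : Measure α} {P : Measure β} [SFinite m] [SFinite P] {X : α → β → ℝ}
    (hX : MemLp (Function.uncurry X) 2 (m.prod P)) : ∀ᵐ ω ∂P, MemLp (fun s => X s ω) 2 m :=
  MemLp.ae_section_left (X := fun ω s => X s ω)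
    (hX.comp_measurePreserving Measure.measurePreserving_swap)

theorem memLp_meanFun {Ω : Type*} [MeasurableSpace Ω] {P : Measure Ω} [IsProbabilityMeasure P]
    {m : Measure ℝ} [SFinite m] {X : ℝ → Ω → ℝ}
    (hX : MemLp (Function.uncurry X) 2 (m.prod P)) : MemLp (meanFun P X) 2 m := by
  have hmeas : AEStronglyMeasurable (meanFun P X) m := hX.1.integral_prod_right'
  rw [memLp_two_iff_integrable_sq hmeas]
  refine hX.integrable_sq.integral_prod_left.mono' (hmeas.pow 2) ?_
  filter_upwards [hX.ae_section_left] with s hs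
  rw [Real.norm_of_nonneg (sq_nonneg _)]
  have h1 := variance_nonneg (X s) P
  rw [variance_eq_sub hs] at h1
  simpa [meanFun, Function.uncurry] using h1

theorem memLp_centered {Ω : Type*} [MeasurableSpace Ω] {P : Measure Ω} [IsProbabilityMeasure P]
    {m : Measure ℝ} [SFinite m] {X : ℝ → Ω → ℝ}
    (hX : MemLp (Function.uncurry X) 2 (m.prod P)) :
    MemLp (Function.uncurry fun s ω => X s ω - meanFun P X s) 2 (m.prod P) :=
  hX.sub ((memLp_meanFun hX).comp_fst P)

/-- For a square integrable process `Y`, Fubini's theorem applies to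
`Y t ω * f t * (Y s ω * f s)`. -/
theorem integrable_mul_mul_of_memLp {Ω : Type*} [MeasurableSpace Ω] {P : Measure Ω}
    [IsProbabilityMeasure P] {m : Measure ℝ} [IsFiniteMeasure m] {Y : ℝ → Ω → ℝ}
    (hY : MemLp (Function.uncurry Y) 2 (m.prod P)) {f : ℝ → ℝ} (hf : MemLp f 2 m) :
    Integrable (fun q : (ℝ × ℝ) × Ω => (Y q.1.1 q.2 * f q.1.1) * (Y q.1.2 q.2 * f q.1.2))
      ((m.prod m).prod P) := by
  have hg : AEStronglyMeasurable (fun q : ℝ × Ω => Y q.1 q.2 * f q.1) (m.prod P) :=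
    hY.1.mul hf.1.comp_fst
  have h1 : AEStronglyMeasurable (fun q : (ℝ × ℝ) × Ω => Y q.1.1 q.2 * f q.1.1)
      ((m.prod m).prod P) :=
    hg.comp_quasiMeasurePreserving
      (MeasureTheory.QuasiMeasurePreserving.prodMap Measure.quasiMeasurePreserving_fst
        (Measure.QuasiMeasurePreserving.id P))
  have h2 : AEStronglyMeasurable (fun q : (ℝ × ℝ) × Ω => Y q.1.2 q.2 * f q.1.2)
      ((m.prod m).prod P) :=
    hg.comp_quasiMeasurePreserving
      (MeasureTheory.QuasiMeasurePreserving.prodMap Measure.quasiMeasurePreserving_snd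
        (Measure.QuasiMeasurePreserving.id P))
  have hsec := hY.ae_section_right
  refine (integrable_prod_iff' (h1.mul h2)).2 ⟨?_, ?_⟩
  · filter_upwards [hsec] with ω hω
    have := hω.integrable_mul hf
    exact this.mul_prod this
  · have hdom : Integrable (fun ω => (∫ s, Y s ω ^ 2 ∂m) * ∫ s, f s ^ 2 ∂m) P :=
      Integrable.mul_const (hY.integrable_sq.integral_prod_right) _
    refine hdom.mono' (h1.mul h2).norm.prod_swap.integral_prod_right' ?_
    filter_upwards [hsec] with ω hω
    rw [Real.norm_of_nonneg (integral_nonneg fun _ => norm_nonneg _)]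
    have : ∫ q : ℝ × ℝ, ‖(Y q.1 ω * f q.1) * (Y q.2 ω * f q.2)‖ ∂(m.prod m)
        = (∫ s, |Y s ω| * |f s| ∂m) ^ 2 := by
      rw [sq, ← integral_prod_mul]
      simp
    refine this.le.trans ?_
    simpa using sq_integral_mul_le hω.abs hf.abs

/-- The quadratic form of the covariance operator is the variance of the coefficient of the
process along `f`. -/
theorem integral_mul_covOperator {Ω : Type*} [MeasurableSpace Ω] {P : Measure Ω}
    [IsProbabilityMeasure P] {t₀ T : ℝ} (hT : t₀ ≤ T) {X : ℝ → Ω → ℝ}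
    (hX : MemLp (Function.uncurry X) 2 ((volume.restrict (Set.Icc t₀ T)).prod P)) {f : ℝ → ℝ}
    (hf : MemLp f 2 (volume.restrict (Set.Icc t₀ T))) :
    ∫ t in Set.Icc t₀ T, f t * covOperator P t₀ T X f t
      = ∫ ω, (∫ s in Set.Icc t₀ T, (X s ω - meanFun P X s) * f s) ^ 2 ∂P := by
  set m := volume.restrict (Set.Icc t₀ T) with hm
  have hint := integrable_mul_mul_of_memLp (memLp_centered hX) hf
  have h1 : ∫ ω, (∫ s, (X s ω - meanFun P X s) * f s ∂m) ^ 2 ∂P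
      = ∫ ω, ∫ q : ℝ × ℝ, ((X q.1 ω - meanFun P X q.1) * f q.1)
        * ((X q.2 ω - meanFun P X q.2) * f q.2) ∂(m.prod m) ∂P := by
    refine integral_congr_ae (.of_forall fun ω => ?_)
    simp only [sq]
    exact (integral_prod_mul _ _).symm
  rw [h1, ← integral_prod_symm _ hint, integral_prod _ hint, integral_prod _ hint.integral_prod_left]
  refine integral_congr_ae (.of_forall fun t => ?_)
  simp only [covOperator, covariance]
  rw [intervalIntegral.integral_of_le hT, ← integral_Icc_eq_integral_Ioc, ← integral_const_mul]
  refine integral_congr_ae (.of_forall fun s => ?_)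
  simp only
  rw [← integral_mul_const, ← integral_const_mul]
  refine integral_congr_ae (.of_forall fun ω => ?_)
  simp only [meanFun]
  ring

/-- In a Hilbert space, the Fourier series of `v` along an orthonormal family converges to `v`
as soon as `v` is orthogonal to all that is orthogonal to the family. -/
theorem Orthonormal.hasSum_of_forall_inner_eq_zero {ι E : Type*} [NormedAddCommGroup E]
    [InnerProductSpace ℝ E] [CompleteSpace E] {e : ι → E} (he : Orthonormal ℝ e) {v : E}
    (hv : ∀ u, (∀ i, inner ℝ u (e i) = 0) → inner ℝ u v = 0) :
    HasSum (fun i => inner ℝ (e i) v • e i) v := by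
  obtain ⟨w, b, hw, hb⟩ := he.toSubtypeRange.exists_hilbertBasis_extension
  have hsum := b.hasSum_repr v
  let g : ι → w := fun i => ⟨e i, hw ⟨i, rfl⟩⟩
  have hg : Function.Injective g := fun i j hij => he.linearIndependent.injective
    (congrArg Subtype.val hij)
  rw [← hg.hasSum_iff] at hsum
  · convert hsum using 1
    ext i
    simp [b.repr_apply_apply, hb, g]
  · intro x hx
    have : inner ℝ (b x) v = 0 := by
      refine hv _ fun i => ?_
      have hne : x ≠ g i := fun h => hx ⟨i, h.symm⟩
      have := b.orthonormal.2 hne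
      rwa [hb] at this ⊢
    simp [b.repr_apply_apply, this]

/-! ### Karhunen-Loève expansions -/

theorem lt_truncLen_iff {J : ℕ∞} {N j : ℕ} : j < truncLen J N ↔ j < N ∧ (j : ℕ∞) < J := by
  have h : ((truncLen J N : ℕ) : ℕ∞) = min (N : ℕ∞) J :=
    ENat.natCast_toNat (ne_top_of_le_ne_top (ENat.natCast_ne_top N) (min_le_left _ _))
  rw [← Nat.cast_lt (α := ℕ∞), h, lt_min_iff, Nat.cast_lt]

theorem natCast_lt_of_lt_truncLen {J : ℕ∞} {N j : ℕ} (h : j < truncLen J N) : (j : ℕ∞) < J :=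
  (lt_truncLen_iff.1 h).2

theorem truncLen_pos {J : ℕ∞} (hJ : 1 ≤ J) {N : ℕ} (hN : 1 ≤ N) : 0 < truncLen J N :=
  lt_truncLen_iff.2 ⟨hN, by simpa using zero_lt_one.trans_le hJ⟩

section KarhunenLoeve

variable {Ω : Type*} [MeasurableSpace Ω] {P : Measure Ω} {t₀ T : ℝ}
  {X : ℝ → Ω → ℝ} {J : ℕ∞} {ν : ℕ → ℝ} {φ : ℕ → ℝ → ℝ} {ξ : ℕ → Ω → ℝ}

theorem IsKarhunenLoeve.orthonormal_toLp (hKL : IsKarhunenLoeve P t₀ T X J ν φ ξ) (hT : t₀ ≤ T) :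
    Orthonormal ℝ fun j : {j : ℕ // (j : ℕ∞) < J} =>
      (hKL.eigenfunction_memLp j j.2).toLp (φ j) := by
  rw [orthonormal_iff_ite]
  intro i j
  have := hKL.orthonormal i j i.2 j.2
  rw [intervalIntegral.integral_of_le hT, ← integral_Icc_eq_integral_Ioc] at this
  rw [inner_toLp_toLp, this]
  simp [Subtype.ext_iff]

/-- The centred process has no component along a function orthogonal to the eigenfunctions: the
variance of this component is the quadratic form of the covariance operator. -/
theorem IsKarhunenLoeve.ae_integral_eq_zero [IsProbabilityMeasure P]
    (hKL : IsKarhunenLoeve P t₀ T X J ν φ ξ)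
    (hT : t₀ ≤ T) (hX : MemLp (Function.uncurry X) 2 ((volume.restrict (Set.Icc t₀ T)).prod P))
    {f : ℝ → ℝ} (hf : MemLp f 2 (volume.restrict (Set.Icc t₀ T)))
    (horth : ∀ j : ℕ, (j : ℕ∞) < J → ∫ s in t₀..T, f s * φ j s = 0) :
    ∀ᵐ ω ∂P, ∫ s in Set.Icc t₀ T, (X s ω - meanFun P X s) * f s = 0 := by
  have hq := integral_mul_covOperator hT hX hf
  have hz : ∫ t in Set.Icc t₀ T, f t * covOperator P t₀ T X f t = 0 := by
    refine integral_eq_zero_of_ae ?_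
    filter_upwards [hKL.exhaustive f hf horth] with t ht
    simp [ht]
  have hint : Integrable
      (fun ω => (∫ s in Set.Icc t₀ T, (X s ω - meanFun P X s) * f s) ^ 2) P := by
    have := (integrable_mul_mul_of_memLp (memLp_centered hX) hf).integral_prod_right
    refine this.congr (.of_forall fun ω => ?_)
    simp only [sq]
    exact integral_prod_mul (fun s => (X s ω - meanFun P X s) * f s)
      fun s => (X s ω - meanFun P X s) * f s
  rw [hz] at hq
  have := (integral_eq_zero_iff_of_nonneg (fun ω => sq_nonneg _) hint).1 hq.symm
  filter_upwards [this] with ω hω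
  simpa using hω

/-- Almost every path of the centred process lies in the closed span of the eigenfunctions: the
null sets of `IsKarhunenLoeve.ae_integral_eq_zero` are united over a countable dense set of
functions orthogonal to the eigenfunctions. -/
theorem IsKarhunenLoeve.ae_forall_inner_eq_zero [IsProbabilityMeasure P]
    (hKL : IsKarhunenLoeve P t₀ T X J ν φ ξ)
    (hT : t₀ ≤ T) (hX : MemLp (Function.uncurry X) 2 ((volume.restrict (Set.Icc t₀ T)).prod P)) :
    ∀ᵐ ω ∂P, ∀ hω : MemLp (fun s => X s ω - meanFun P X s) 2 (volume.restrict (Set.Icc t₀ T)),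
      ∀ u : Lp ℝ 2 (volume.restrict (Set.Icc t₀ T)),
        (∀ j : {j : ℕ // (j : ℕ∞) < J},
          inner ℝ u ((hKL.eigenfunction_memLp j j.2).toLp (φ j)) = 0) →
        inner ℝ u (hω.toLp _) = 0 := by
  let S : Set (Lp ℝ 2 (volume.restrict (Set.Icc t₀ T))) := {u | ∀ j : {j : ℕ // (j : ℕ∞) < J},
    inner ℝ u ((hKL.eigenfunction_memLp j j.2).toLp (φ j)) = 0}
  have : Fact ((2 : ℝ≥0∞) ≠ ∞) := ⟨ENNReal.ofNat_ne_top⟩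
  have : Nonempty S := ⟨⟨0, fun j => inner_zero_left _⟩⟩
  have hd : ∀ k : ℕ, ∀ᵐ ω ∂P, ∫ s in Set.Icc t₀ T, (X s ω - meanFun P X s)
      * (TopologicalSpace.denseSeq S k : Lp ℝ 2 (volume.restrict (Set.Icc t₀ T))) s = 0 := by
    intro k
    refine hKL.ae_integral_eq_zero hT hX (Lp.memLp _) fun j hj => ?_
    have := (TopologicalSpace.denseSeq S k).2 ⟨j, hj⟩
    rw [← Lp.toLp_coeFn (TopologicalSpace.denseSeq S k).1 (Lp.memLp _),
      inner_toLp_toLp] at this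
    rwa [intervalIntegral.integral_of_le hT, ← integral_Icc_eq_integral_Ioc]
  filter_upwards [ae_all_iff.2 hd] with ω hdω hω u hu
  have heq : (fun u : S => inner ℝ (u : Lp ℝ 2 _) (hω.toLp _)) = fun _ => (0 : ℝ) := by
    refine (TopologicalSpace.denseRange_denseSeq S).equalizer (by fun_prop) continuous_const ?_
    ext k
    have := hdω k
    simp only [Function.comp]
    rw [← Lp.toLp_coeFn (TopologicalSpace.denseSeq S k).1 (Lp.memLp _),
      inner_toLp_toLp, ← this]
    simp only [mul_comm]
  exact congrFun heq ⟨u, hu⟩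

theorem IsKarhunenLoeve.coeff_eq_inner (hKL : IsKarhunenLoeve P t₀ T X J ν φ ξ) (hT : t₀ ≤ T) :
    ∀ᵐ ω ∂P, ∀ hω : MemLp (fun s => X s ω - meanFun P X s) 2 (volume.restrict (Set.Icc t₀ T)),
      ∀ j : {j : ℕ // (j : ℕ∞) < J}, Real.sqrt (ν j) * ξ j ω
        = inner ℝ ((hKL.eigenfunction_memLp j j.2).toLp (φ j)) (hω.toLp _) := by
  have : ∀ᵐ ω ∂P, ∀ j : {j : ℕ // (j : ℕ∞) < J},
      Real.sqrt (ν j) * ξ j ω = ∫ s in t₀..T, (X s ω - meanFun P X s) * φ j s :=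
    ae_all_iff.2 fun j => hKL.coeff_eq j j.2
  filter_upwards [this] with ω h hω j
  rw [h j, inner_toLp_toLp, intervalIntegral.integral_of_le hT, ← integral_Icc_eq_integral_Ioc]
  simp only [mul_comm]

/-- The Karhunen-Loève expansion of almost every path converges in `L²`, hence in `L¹`. -/
theorem IsKarhunenLoeve.ae_tendsto_partialSum [IsProbabilityMeasure P]
    (hKL : IsKarhunenLoeve P t₀ T X J ν φ ξ)
    (hT : t₀ ≤ T) (hX : MemLp (Function.uncurry X) 2 ((volume.restrict (Set.Icc t₀ T)).prod P)) :
    ∀ᵐ ω ∂P, IntegrableOn (fun s => X s ω) (Set.Icc t₀ T) ∧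
      Tendsto (fun N => ∫ s in Set.Icc t₀ T,
        |partialSum (meanFun P X) ν φ (firstVec ξ (truncLen J N) ω) s - X s ω|) atTop (𝓝 0) := by
  filter_upwards [hX.ae_section_right, (memLp_centered hX).ae_section_right,
    hKL.ae_forall_inner_eq_zero hT hX, hKL.coeff_eq_inner hT] with ω h1 h2 h3 h4
  refine ⟨h1.integrable one_le_two, ?_⟩
  have hsum := (hKL.orthonormal_toLp hT).hasSum_of_forall_inner_eq_zero (h3 h2)
  simp_rw [← h4 h2] at hsum
  let F : ℕ → Finset {j : ℕ // (j : ℕ∞) < J} := fun N =>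
    (Finset.univ : Finset (Fin (truncLen J N))).map
      ⟨fun j : Fin (truncLen J N) => ⟨j, natCast_lt_of_lt_truncLen j.2⟩, fun i j h => by simpa [Fin.ext_iff] using h⟩
  have hF : Tendsto F atTop atTop := by
    have hmem : ∀ N (x : {j : ℕ // (j : ℕ∞) < J}), x ∈ F N ↔ (x : ℕ) < N := by
      intro N x
      simp only [F, Finset.mem_map, Finset.mem_univ, true_and]
      constructor
      · rintro ⟨j, rfl⟩
        exact (lt_truncLen_iff.1 j.2).1
      · intro hx
        exact ⟨⟨x, lt_truncLen_iff.2 ⟨hx, x.2⟩⟩, rfl⟩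
    refine tendsto_atTop_finset_of_monotone (fun M N hMN x hx => ?_) fun x => ⟨x + 1, ?_⟩
    · rw [hmem] at hx ⊢
      omega
    · rw [hmem]
      omega
  have hlim := hsum.comp hF
  rw [tendsto_iff_norm_sub_tendsto_zero] at hlim
  have hbound : ∀ N, ∫ s in Set.Icc t₀ T,
        |partialSum (meanFun P X) ν φ (firstVec ξ (truncLen J N) ω) s - X s ω|
      ≤ ‖(∑ j ∈ F N, (Real.sqrt (ν j) * ξ j ω) • (hKL.eigenfunction_memLp j j.2).toLp (φ j))
          - h2.toLp _‖ * Real.sqrt (T - t₀) := by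
    intro N
    have hmem : MemLp (fun s => partialSum (meanFun P X) ν φ (firstVec ξ (truncLen J N) ω) s
        - X s ω) 2 (volume.restrict (Set.Icc t₀ T)) := by
      refine MemLp.sub (MemLp.add (memLp_meanFun hX) (memLp_finsetSum _ fun j _ => ?_)) h1
      exact ((hKL.eigenfunction_memLp j (natCast_lt_of_lt_truncLen j.2)).const_mul _).mul_const _
    have heq : (∑ j ∈ F N, (Real.sqrt (ν j) * ξ j ω) • (hKL.eigenfunction_memLp j j.2).toLp (φ j))
          - h2.toLp _ = hmem.toLp _ := by
      refine Lp.ext ?_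
      have hae : ∀ᵐ s ∂(volume.restrict (Set.Icc t₀ T)), ∀ j : {j : ℕ // (j : ℕ∞) < J},
          ((Real.sqrt (ν j) * ξ j ω) • (hKL.eigenfunction_memLp j j.2).toLp (φ j)) s
            = Real.sqrt (ν j) * ξ j ω * φ j s := by
        refine ae_all_iff.2 fun j => ?_
        filter_upwards [Lp.coeFn_smul (Real.sqrt (ν j) * ξ j ω)
          ((hKL.eigenfunction_memLp j j.2).toLp (φ j)),
          (hKL.eigenfunction_memLp j j.2).coeFn_toLp] with s hs1 hs2
        rw [hs1, Pi.smul_apply, hs2, smul_eq_mul]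
      filter_upwards [Lp.coeFn_sub (∑ j ∈ F N,
          (Real.sqrt (ν j) * ξ j ω) • (hKL.eigenfunction_memLp j j.2).toLp (φ j)) (h2.toLp _),
        Lp.coeFn_finsetSum (F N) fun j : {j : ℕ // (j : ℕ∞) < J} =>
          (Real.sqrt (ν j) * ξ j ω) • (hKL.eigenfunction_memLp j j.2).toLp (φ j),
        h2.coeFn_toLp, hmem.coeFn_toLp, hae] with s e1 e2 e3 e4 e5
      rw [e1, Pi.sub_apply, e2, e3, e4, Finset.sum_apply, Finset.sum_congr rfl fun j _ => e5 j,
        Finset.sum_map]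
      change (∑ j : Fin (truncLen J N), Real.sqrt (ν j) * ξ j ω * φ j s) - _ = _
      simp only [partialSum, firstVec]
      have : ∀ j : Fin (truncLen J N), Real.sqrt (ν j) * φ j s * ξ j ω
        = Real.sqrt (ν j) * ξ j ω * φ j s := fun j => by ring
      simp only [this]
      ring
    rw [heq]
    have hcs := sq_integral_mul_le hmem.norm (memLp_const (1 : ℝ))
    have hn := norm_toLp_sq hmem
    simp only [mul_one, Real.norm_eq_abs, sq_abs, one_pow, ← hn] at hcs
    have h1 : ∫ s in Set.Icc t₀ T, (1 : ℝ) = T - t₀ := by simp [hT]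
    rw [h1] at hcs
    refine abs_le_of_sq_le_sq' ?_ (by positivity) |>.2
    rw [mul_pow, Real.sq_sqrt (by linarith)]
    exact hcs
  refine squeeze_zero (fun N => integral_nonneg fun _ => abs_nonneg _) hbound ?_
  simpa using hlim.mul_const (Real.sqrt (T - t₀))

/-- Bessel's inequality for the eigenfunctions. -/
theorem IsKarhunenLoeve.sum_sq_integral_mul_le (hKL : IsKarhunenLoeve P t₀ T X J ν φ ξ)
    (hT : t₀ ≤ T) {n : ℕ} (hn : (n : ℕ∞) ≤ J) {v : ℝ → ℝ}
    (hv : MemLp v 2 (volume.restrict (Set.Icc t₀ T))) :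
    ∑ j : Fin n, (∫ s in Set.Icc t₀ T, φ j s * v s) ^ 2 ≤ ∫ s in Set.Icc t₀ T, v s ^ 2 := by
  have hlt : ∀ j : Fin n, ((j : ℕ) : ℕ∞) < J := fun j =>
    lt_of_lt_of_le (Nat.cast_lt.2 j.2) hn
  have ho := (hKL.orthonormal_toLp hT).comp
    (fun j : Fin n => (⟨j, hlt j⟩ : {j : ℕ // (j : ℕ∞) < J}))
    fun i j h => by simpa [Fin.ext_iff] using h
  have := ho.sum_inner_products_le (hv.toLp v) (s := Finset.univ)
  simpa only [Function.comp, inner_toLp_toLp, norm_toLp_sq, Real.norm_eq_abs, sq_abs] using this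

/-- The covariance operator has finite trace. -/
theorem IsKarhunenLoeve.sum_eigenvalue_le [IsProbabilityMeasure P]
    (hKL : IsKarhunenLoeve P t₀ T X J ν φ ξ) (hT : t₀ ≤ T)
    (hX : MemLp (Function.uncurry X) 2 ((volume.restrict (Set.Icc t₀ T)).prod P)) {n : ℕ}
    (hn : (n : ℕ∞) ≤ J) :
    ∑ j : Fin n, ν j ≤ ∫ ω, (∫ s in Set.Icc t₀ T, (X s ω - meanFun P X s) ^ 2) ∂P := by
  have hlt : ∀ j : Fin n, ((j : ℕ) : ℕ∞) < J := fun j =>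
    lt_of_lt_of_le (Nat.cast_lt.2 j.2) hn
  have hint : ∀ j : Fin n, Integrable (fun ω => (Real.sqrt (ν j) * ξ j ω) ^ 2) P := fun j =>
    ((hKL.coeff_memLp j (hlt j)).const_mul _).integrable_sq
  have hν : ∀ j : Fin n, ν j = ∫ ω, (Real.sqrt (ν j) * ξ j ω) ^ 2 ∂P := fun j => by
    have h1 := variance_eq_sub (hKL.coeff_memLp j (hlt j))
    rw [hKL.coeff_variance j (hlt j), hKL.coeff_mean j (hlt j)] at h1
    simp only [mul_pow]
    rw [integral_const_mul, Real.sq_sqrt (hKL.eigenvalue_nonneg j (hlt j))]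
    have h2 : ∫ ω, ξ j ω ^ 2 ∂P = 1 := by simpa using h1.symm
    rw [h2, mul_one]
  rw [Finset.sum_congr rfl fun j _ => hν j, ← integral_finsetSum _ fun j _ => hint j]
  refine integral_mono_ae (integrable_finsetSum _ fun j _ => hint j)
    (memLp_centered hX).integrable_sq.integral_prod_right ?_
  filter_upwards [(memLp_centered hX).ae_section_right, hKL.coeff_eq_inner hT] with ω h1 h2
  refine le_of_eq_of_le ?_ (hKL.sum_sq_integral_mul_le hT hn h1)
  refine Finset.sum_congr rfl fun j _ => ?_
  rw [h2 h1 ⟨j, hlt j⟩, inner_toLp_toLp]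

theorem intPartialSum_eq {μ : ℝ → ℝ} {n : ℕ} (hμ : IntegrableOn μ (Set.Icc t₀ T))
    (hφ : ∀ j : Fin n, IntegrableOn (φ j) (Set.Icc t₀ T)) (y : Fin n → ℝ) {s : ℝ}
    (hs : s ∈ Set.Icc t₀ T) :
    intPartialSum t₀ μ ν φ y s
      = (∫ r in t₀..s, μ r) + ∑ j : Fin n, Real.sqrt (ν j) * y j * ∫ r in t₀..s, φ j r := by
  have hsub : Set.uIcc t₀ s ⊆ Set.Icc t₀ T := by
    rw [Set.uIcc_of_le hs.1]
    exact Set.Icc_subset_Icc_right hs.2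
  have h1 : IntervalIntegrable μ volume t₀ s := (hμ.mono_set hsub).intervalIntegrable
  have h2 : ∀ j : Fin n, IntervalIntegrable (fun r => Real.sqrt (ν j) * φ j r * y j) volume t₀ s :=
    fun j => ((((hφ j).mono_set hsub).intervalIntegrable).const_mul _).mul_const _
  simp only [intPartialSum, partialSum]
  rw [intervalIntegral.integral_add h1, intervalIntegral.integral_finsetSum fun j _ => h2 j]
  · congr 1
    refine Finset.sum_congr rfl fun j _ => ?_
    rw [intervalIntegral.integral_mul_const, intervalIntegral.integral_const_mul]
    ring
  · simpa only [Finset.sum_fn] using IntervalIntegrable.sum Finset.univ fun j _ => h2 j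

/-- The integrals `K_a` of the truncated expansions are bounded uniformly in the order of the
truncation: by Bessel's inequality the coefficients of indicator functions along the
eigenfunctions are square summable, and so are the `√(ν j)`. -/
theorem IsKarhunenLoeve.exists_bound_intPartialSum [IsProbabilityMeasure P]
    (hKL : IsKarhunenLoeve P t₀ T X J ν φ ξ) (hT : t₀ ≤ T)
    (hX : MemLp (Function.uncurry X) 2 ((volume.restrict (Set.Icc t₀ T)).prod P)) {A : ℝ}
    (hA : 0 ≤ A) :
    ∃ C, ∀ n : ℕ, (n : ℕ∞) ≤ J → ∀ y : Fin n → ℝ, (∀ j, |y j| ≤ A) → ∀ s ∈ Set.Icc t₀ T,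
      |intPartialSum t₀ (meanFun P X) ν φ y s| ≤ C := by
  set S := ∫ ω, (∫ s in Set.Icc t₀ T, (X s ω - meanFun P X s) ^ 2) ∂P
  have hμ : IntegrableOn (meanFun P X) (Set.Icc t₀ T) := (memLp_meanFun hX).integrable one_le_two
  refine ⟨(∫ r in Set.Icc t₀ T, |meanFun P X r|) + A / 2 * (S + (T - t₀)), ?_⟩
  intro n hn y hy s hs
  have hlt : ∀ j : Fin n, ((j : ℕ) : ℕ∞) < J := fun j =>
    lt_of_lt_of_le (Nat.cast_lt.2 j.2) hn
  rw [intPartialSum_eq hμ (fun j => (hKL.eigenfunction_memLp j (hlt j)).integrable one_le_two) y hs]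
  refine (abs_add_le _ _).trans (add_le_add ?_ ?_)
  · rw [intervalIntegral.integral_of_le hs.1]
    refine (abs_integral_le_integral_abs).trans (setIntegral_mono_set hμ.abs
      (.of_forall fun _ => abs_nonneg _) ?_)
    exact (Set.Ioc_subset_Icc_self.trans (Set.Icc_subset_Icc_right hs.2)).eventuallyLE
  · have hind : MemLp ((Set.Icc t₀ s).indicator fun _ => (1 : ℝ)) 2
        (volume.restrict (Set.Icc t₀ T)) := (memLp_const 1).indicator measurableSet_Icc
    have hcoef : ∀ j : Fin n, ∫ r in Set.Icc t₀ T, φ j r * (Set.Icc t₀ s).indicator (fun _ => 1) r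
        = ∫ r in t₀..s, φ j r := fun j => by
      have : ∀ r, φ j r * (Set.Icc t₀ s).indicator (fun _ => (1 : ℝ)) r
          = (Set.Icc t₀ s).indicator (φ j) r := fun r => by
        by_cases hr : r ∈ Set.Icc t₀ s <;> simp [hr]
      simp only [this]
      rw [setIntegral_indicator measurableSet_Icc, intervalIntegral.integral_of_le hs.1,
        ← integral_Icc_eq_integral_Ioc,
        Set.inter_eq_right.2 (Set.Icc_subset_Icc_right hs.2)]
    have hB := hKL.sum_sq_integral_mul_le hT hn hind
    simp only [hcoef] at hB
    have hB2 : ∫ r in Set.Icc t₀ T, (Set.Icc t₀ s).indicator (fun _ => (1 : ℝ)) r ^ 2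
        ≤ T - t₀ := by
      calc _ ≤ ∫ r in Set.Icc t₀ T, (1 : ℝ) := by
            refine integral_mono hind.integrable_sq (integrable_const _) fun r => ?_
            by_cases hr : r ∈ Set.Icc t₀ s <;> simp [hr]
        _ = T - t₀ := by simp [hT]
    calc |∑ j : Fin n, Real.sqrt (ν j) * y j * ∫ r in t₀..s, φ j r|
        ≤ ∑ j : Fin n, A / 2 * (ν j + (∫ r in t₀..s, φ j r) ^ 2) := by
          refine (Finset.abs_sum_le_sum_abs _ _).trans (Finset.sum_le_sum fun j _ => ?_)
          rw [abs_mul, abs_mul, abs_of_nonneg (Real.sqrt_nonneg _)]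
          have h1 := Real.sq_sqrt (hKL.eigenvalue_nonneg j (hlt j))
          have h2 := two_mul_le_add_sq (Real.sqrt (ν j)) |∫ r in t₀..s, φ j r|
          rw [h1, sq_abs] at h2
          have h3 : 0 ≤ Real.sqrt (ν j) * |∫ r in t₀..s, φ j r| := by positivity
          nlinarith [mul_le_mul_of_nonneg_left (hy j) h3, mul_le_mul_of_nonneg_left h2 hA]
      _ = A / 2 * (∑ j : Fin n, ν j + ∑ j : Fin n, (∫ r in t₀..s, φ j r) ^ 2) := by
          rw [← Finset.mul_sum, Finset.sum_add_distrib]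
      _ ≤ A / 2 * (S + (T - t₀)) := by
          have := hKL.sum_eigenvalue_le hT hX hn
          gcongr
          exact hB.trans hB2

end KarhunenLoeve

/-! ### The solution formula and its dependence on the coefficients -/

theorem intervalIntegrable_of_integrableOn_Icc {f : ℝ → ℝ} {t₀ T : ℝ}
    (hf : IntegrableOn f (Set.Icc t₀ T)) {r s : ℝ} (hr : r ∈ Set.Icc t₀ T)
    (hs : s ∈ Set.Icc t₀ T) : IntervalIntegrable f volume r s :=
  (hf.mono_set (Set.uIcc_subset_Icc hr hs)).intervalIntegrable

theorem continuousOn_integral_Icc {f : ℝ → ℝ} {t₀ T : ℝ} (hT : t₀ ≤ T)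
    (hf : IntegrableOn f (Set.Icc t₀ T)) :
    ContinuousOn (fun s => ∫ r in t₀..s, f r) (Set.Icc t₀ T) := by
  have := intervalIntegral.continuousOn_primitive_interval (f := f) (a := t₀) (b := T)
    (μ := volume) (by rwa [Set.uIcc_of_le hT])
  rwa [Set.uIcc_of_le hT] at this

theorem linearSolution_eq {t₀ t x₀ : ℝ} (ht : t₀ ≤ t) {a b : ℝ → ℝ}
    (ha : IntegrableOn a (Set.Icc t₀ t)) :
    linearSolution t₀ x₀ a b t = Real.exp (∫ s in t₀..t, a s)
      * (x₀ + ∫ s in t₀..t, b s * Real.exp (-∫ r in t₀..s, a r)) := by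
  rw [linearSolution, mul_add, mul_comm x₀, ← intervalIntegral.integral_const_mul]
  congr 1
  refine intervalIntegral.integral_congr fun s hs => ?_
  rw [Set.uIcc_of_le ht] at hs
  have hl : t₀ ∈ Set.Icc t₀ t := ⟨le_rfl, ht⟩
  have hr : t ∈ Set.Icc t₀ t := ⟨ht, le_rfl⟩
  have h := intervalIntegral.integral_add_adjacent_intervals
    (intervalIntegrable_of_integrableOn_Icc ha hl hs)
    (intervalIntegrable_of_integrableOn_Icc ha hs hr)
  rw [← h, Real.exp_add, Real.exp_neg]
  field_simp

theorem integrableOn_partialSum {μ : ℝ → ℝ} {ν : ℕ → ℝ} {φ : ℕ → ℝ → ℝ} {n : ℕ} {t₀ T : ℝ}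
    (hμ : IntegrableOn μ (Set.Icc t₀ T))
    (hφ : ∀ j : Fin n, IntegrableOn (φ j) (Set.Icc t₀ T)) (y : Fin n → ℝ) :
    IntegrableOn (partialSum μ ν φ y) (Set.Icc t₀ T) :=
  hμ.add (integrable_finsetSum _ fun j _ => ((hφ j).const_mul _).mul_const _)

theorem partialSum_firstVec {Ω : Type*} {μ : ℝ → ℝ} {γ : ℕ → ℝ} {ψ : ℕ → ℝ → ℝ} {η : ℕ → Ω → ℝ}
    {m : ℕ} (hm : 0 < m) (ω : Ω) (s : ℝ) :
    partialSum μ γ ψ (firstVec η m ω) s = Real.sqrt (γ 0) * ψ 0 s * η 0 ω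
      + partialSum μ (dropFirst γ) (dropFirst ψ) (firstVec (dropFirst η) (m - 1) ω) s := by
  obtain ⟨k, rfl⟩ : ∃ k, m = k + 1 := ⟨m - 1, by omega⟩
  simp only [partialSum, firstVec, Fin.sum_univ_succ, dropFirst, Fin.val_zero, Fin.val_succ]
  exact add_left_comm _ _ _

theorem integrableOn_mul_exp {h u : ℝ → ℝ} {t₀ T : ℝ} (hh : IntegrableOn h (Set.Icc t₀ T))
    (hu : ContinuousOn u (Set.Icc t₀ T)) :
    IntegrableOn (fun s => h s * Real.exp (-u s)) (Set.Icc t₀ T) :=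
  hh.mul_continuousOn (Real.continuous_exp.comp_continuousOn hu.neg) isCompact_Icc

theorem integral_mul_exp_pos {h u : ℝ → ℝ} {t₀ T t : ℝ} (ht : t ∈ Set.Ioc t₀ T)
    (hh : IntegrableOn h (Set.Icc t₀ T)) (hpos : ∀ s ∈ Set.Ioo t₀ T, 0 < h s)
    (hu : ContinuousOn u (Set.Icc t₀ T)) :
    0 < ∫ s in t₀..t, h s * Real.exp (-u s) := by
  refine intervalIntegral.intervalIntegral_pos_of_pos_on ?_ (fun s hs => ?_) ht.1
  · exact intervalIntegrable_of_integrableOn_Icc (integrableOn_mul_exp hh hu)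
      ⟨le_rfl, ht.1.le.trans ht.2⟩ ⟨ht.1.le, ht.2⟩
  · exact mul_pos (hpos s ⟨hs.1, hs.2.trans_le ht.2⟩) (Real.exp_pos _)

section Coefficients

variable {μ : ℝ → ℝ} {ν : ℕ → ℝ} {φ : ℕ → ℝ → ℝ} {n : ℕ} {t₀ T t : ℝ}

theorem continuousOn_intPartialSum (hT : t₀ ≤ T) (hμ : IntegrableOn μ (Set.Icc t₀ T))
    (hφ : ∀ j : Fin n, IntegrableOn (φ j) (Set.Icc t₀ T)) (y : Fin n → ℝ) :
    ContinuousOn (fun s => intPartialSum t₀ μ ν φ y s) (Set.Icc t₀ T) :=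
  continuousOn_integral_Icc hT (integrableOn_partialSum hμ hφ y)

theorem continuous_intPartialSum (hμ : IntegrableOn μ (Set.Icc t₀ T))
    (hφ : ∀ j : Fin n, IntegrableOn (φ j) (Set.Icc t₀ T)) {s : ℝ} (hs : s ∈ Set.Icc t₀ T) :
    Continuous fun y : Fin n → ℝ => intPartialSum t₀ μ ν φ y s := by
  simp only [fun y : Fin n → ℝ => intPartialSum_eq (ν := ν) hμ hφ y hs]
  fun_prop

theorem continuous_integral_mul_exp (ht : t ∈ Set.Icc t₀ T) (hμ : IntegrableOn μ (Set.Icc t₀ T))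
    (hφ : ∀ j : Fin n, IntegrableOn (φ j) (Set.Icc t₀ T)) {h : ℝ → ℝ}
    (hh : IntegrableOn h (Set.Icc t₀ T)) :
    Continuous fun y : Fin n → ℝ =>
      ∫ s in t₀..t, h s * Real.exp (-intPartialSum t₀ μ ν φ y s) := by
  have hT : t₀ ≤ T := ht.1.trans ht.2
  have hsub : Set.uIoc t₀ t ⊆ Set.Icc t₀ T := by
    rw [Set.uIoc_of_le ht.1]
    exact Set.Ioc_subset_Icc_self.trans (Set.Icc_subset_Icc_right ht.2)
  rw [continuous_iff_continuousAt]
  intro y₀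
  -- a bound of the exponents, uniform in `s`, on the unit ball around `y₀`
  let C := (∫ r in Set.Icc t₀ T, |μ r|)
    + ∑ j : Fin n, Real.sqrt (ν j) * (|y₀ j| + 1) * ∫ r in Set.Icc t₀ T, |φ j r|
  have hprim : ∀ {f : ℝ → ℝ}, IntegrableOn f (Set.Icc t₀ T) → ∀ s ∈ Set.Icc t₀ T,
      |∫ r in t₀..s, f r| ≤ ∫ r in Set.Icc t₀ T, |f r| := by
    intro f hf s hs
    rw [intervalIntegral.integral_of_le hs.1]
    refine (abs_integral_le_integral_abs).trans (setIntegral_mono_set hf.abs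
      (.of_forall fun _ => abs_nonneg _) ?_)
    exact (Set.Ioc_subset_Icc_self.trans (Set.Icc_subset_Icc_right hs.2)).eventuallyLE
  have hC : ∀ y ∈ Metric.ball y₀ 1, ∀ s ∈ Set.Icc t₀ T, |intPartialSum t₀ μ ν φ y s| ≤ C := by
    intro y hy s hs
    rw [intPartialSum_eq hμ hφ y hs]
    refine (abs_add_le _ _).trans (add_le_add (hprim hμ s hs) ?_)
    refine (Finset.abs_sum_le_sum_abs _ _).trans (Finset.sum_le_sum fun j _ => ?_)
    rw [abs_mul, abs_mul, abs_of_nonneg (Real.sqrt_nonneg _)]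
    have h1 : |y j| ≤ |y₀ j| + 1 := by
      have h2 : dist (y j) (y₀ j) < 1 := (dist_le_pi_dist y y₀ j).trans_lt hy
      rw [Real.dist_eq] at h2
      have := abs_sub_abs_le_abs_sub (y j) (y₀ j)
      linarith
    exact mul_le_mul (mul_le_mul_of_nonneg_left h1 (Real.sqrt_nonneg _)) (hprim (hφ j) s hs)
      (abs_nonneg _) (by positivity)
  refine intervalIntegral.continuousAt_of_dominated_interval
    (bound := fun s => |h s| * Real.exp C) ?_ ?_ ?_ ?_
  · refine .of_forall fun y => ?_
    exact ((integrableOn_mul_exp hh (continuousOn_intPartialSum hT hμ hφ y)).mono_set hsub).1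
  · filter_upwards [Metric.ball_mem_nhds y₀ one_pos] with y hy
    refine .of_forall fun s hs => ?_
    rw [Real.norm_eq_abs, abs_mul, Real.abs_exp]
    gcongr
    exact (neg_le_abs _).trans (hC y hy s (hsub hs))
  · exact (intervalIntegrable_of_integrableOn_Icc hh ⟨le_rfl, hT⟩ ht).abs.mul_const _
  · refine .of_forall fun s hs => ?_
    have := continuous_intPartialSum (ν := ν) hμ hφ (hsub hs)
    fun_prop

theorem continuous_integral_partialSum_mul_exp {μ' : ℝ → ℝ} {γ : ℕ → ℝ} {ψ : ℕ → ℝ → ℝ} {m : ℕ}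
    (ht : t ∈ Set.Icc t₀ T) (hμ : IntegrableOn μ (Set.Icc t₀ T))
    (hφ : ∀ j : Fin n, IntegrableOn (φ j) (Set.Icc t₀ T)) (hμ' : IntegrableOn μ' (Set.Icc t₀ T))
    (hψ : ∀ j : Fin m, IntegrableOn (ψ j) (Set.Icc t₀ T)) :
    Continuous fun p : (Fin n → ℝ) × (Fin m → ℝ) =>
      ∫ s in t₀..t, partialSum μ' γ ψ p.2 s * Real.exp (-intPartialSum t₀ μ ν φ p.1 s) := by
  have hT : t₀ ≤ T := ht.1.trans ht.2
  have hii : ∀ {h : ℝ → ℝ}, IntegrableOn h (Set.Icc t₀ T) → ∀ y : Fin n → ℝ,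
      IntervalIntegrable (fun s => h s * Real.exp (-intPartialSum t₀ μ ν φ y s)) volume t₀ t :=
    fun hh y => intervalIntegrable_of_integrableOn_Icc
      (integrableOn_mul_exp hh (continuousOn_intPartialSum hT hμ hφ y)) ⟨le_rfl, hT⟩ ht
  have heq : ∀ p : (Fin n → ℝ) × (Fin m → ℝ),
      ∫ s in t₀..t, partialSum μ' γ ψ p.2 s * Real.exp (-intPartialSum t₀ μ ν φ p.1 s)
      = (∫ s in t₀..t, μ' s * Real.exp (-intPartialSum t₀ μ ν φ p.1 s))
        + ∑ i : Fin m, Real.sqrt (γ i) * p.2 i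
          * ∫ s in t₀..t, ψ i s * Real.exp (-intPartialSum t₀ μ ν φ p.1 s) := by
    intro p
    have h2 : ∀ i : Fin m, IntervalIntegrable (fun s => Real.sqrt (γ i) * p.2 i
        * (ψ i s * Real.exp (-intPartialSum t₀ μ ν φ p.1 s))) volume t₀ t :=
      fun i => (hii (hψ i) p.1).const_mul _
    have h3 : IntervalIntegrable (fun s => ∑ i : Fin m, Real.sqrt (γ i) * p.2 i
        * (ψ i s * Real.exp (-intPartialSum t₀ μ ν φ p.1 s))) volume t₀ t := by
      simpa only [Finset.sum_fn] using IntervalIntegrable.sum Finset.univ fun i _ => h2 i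
    simp only [← intervalIntegral.integral_const_mul]
    rw [← intervalIntegral.integral_finsetSum fun i _ => h2 i,
      ← intervalIntegral.integral_add (hii hμ' p.1) h3]
    refine intervalIntegral.integral_congr fun s _ => ?_
    simp only [partialSum, add_mul, Finset.sum_mul]
    congr 1
    refine Finset.sum_congr rfl fun i _ => ?_
    ring
  simp only [heq]
  have h0 := continuous_integral_mul_exp (ν := ν) ht hμ hφ hμ'
  have h1 : ∀ i : Fin m, _ := fun i => continuous_integral_mul_exp (ν := ν) ht hμ hφ (hψ i)
  refine (h0.comp continuous_fst).add (continuous_finsetSum _ fun i _ => ?_)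
  exact (by fun_prop : Continuous fun p : (Fin n → ℝ) × (Fin m → ℝ) =>
    Real.sqrt (γ i) * p.2 i).mul ((h1 i).comp continuous_fst)

end Coefficients

/-! ### The density of the truncated solution -/

/-- Integrability on `[t₀, T]` of the mean functions and of the functions of the first `n`, resp.
`m`, terms of two expansions. -/
structure IntegrableCoeffs (t₀ T : ℝ) (μa μb : ℝ → ℝ) (φ ψ : ℕ → ℝ → ℝ) (n m : ℕ) : Prop where
  mean_a : IntegrableOn μa (Set.Icc t₀ T)
  mean_b : IntegrableOn μb (Set.Icc t₀ T)
  eigen_a : ∀ j : Fin n, IntegrableOn (φ j) (Set.Icc t₀ T)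
  eigen_b : ∀ i : Fin m, IntegrableOn (ψ i) (Set.Icc t₀ T)

/-- The coefficient `√(γ 0) ∫_{t₀}^t ψ_0(s) exp(-K(s, y)) ds` with which the first random
coefficient of `b` enters `exp(-K(t, y)) x(t)`. -/
noncomputable def etaScale (t₀ : ℝ) (μa : ℝ → ℝ) (ν γ : ℕ → ℝ) (φ ψ : ℕ → ℝ → ℝ) {n : ℕ} (t : ℝ)
    (y : Fin n → ℝ) : ℝ :=
  Real.sqrt (γ 0) * ∫ s in t₀..t, ψ 0 s * Real.exp (-intPartialSum t₀ μa ν φ y s)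

/-- The contribution to `exp(-K(t, y)) x(t)` of the mean of `b` and of all its random
coefficients but the first one. -/
noncomputable def discountedTail (t₀ : ℝ) (μa μb : ℝ → ℝ) (ν γ : ℕ → ℝ) (φ ψ : ℕ → ℝ → ℝ) {n k : ℕ} (t : ℝ)
    (w : (Fin n → ℝ) × (Fin k → ℝ)) : ℝ :=
  ∫ s in t₀..t, partialSum μb (dropFirst γ) (dropFirst ψ) w.2 s
    * Real.exp (-intPartialSum t₀ μa ν φ w.1 s)

section Truncated

variable {Ω : Type*} {t₀ T t A : ℝ} {μa μb : ℝ → ℝ}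
  {ν γ : ℕ → ℝ} {φ ψ : ℕ → ℝ → ℝ} {n m : ℕ}

theorem IntegrableCoeffs.etaScale_pos (h : IntegrableCoeffs t₀ T μa μb φ ψ n m) (hm : 0 < m)
    (ht : t ∈ Set.Ioc t₀ T) (hγ : 0 < γ 0) (hψ : ∀ s ∈ Set.Ioo t₀ T, 0 < ψ 0 s)
    (y : Fin n → ℝ) : 0 < etaScale t₀ μa ν γ φ ψ t y :=
  mul_pos (Real.sqrt_pos.2 hγ) (integral_mul_exp_pos ht (h.eigen_b ⟨0, hm⟩) hψ
    (continuousOn_intPartialSum (ht.1.le.trans ht.2) h.mean_a h.eigen_a y))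

theorem IntegrableCoeffs.continuous_etaScale (h : IntegrableCoeffs t₀ T μa μb φ ψ n m)
    (hm : 0 < m) (ht : t ∈ Set.Icc t₀ T) : Continuous (etaScale t₀ μa ν γ φ ψ t (n := n)) :=
  continuous_const.mul (continuous_integral_mul_exp ht h.mean_a h.eigen_a (h.eigen_b ⟨0, hm⟩))

theorem IntegrableCoeffs.continuous_discountedTail (h : IntegrableCoeffs t₀ T μa μb φ ψ n m)
    (ht : t ∈ Set.Icc t₀ T) :
    Continuous (discountedTail t₀ μa μb ν γ φ ψ t (n := n) (k := m - 1)) :=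
  continuous_integral_partialSum_mul_exp ht h.mean_a h.eigen_a h.mean_b
    fun i => h.eigen_b ⟨i + 1, by omega⟩

/-- The integral of `S_b exp(-K)` splits into the part carried by the first random coefficient of
`b` and the rest. -/
theorem IntegrableCoeffs.integral_partialSum_firstVec (h : IntegrableCoeffs t₀ T μa μb φ ψ n m)
    (hm : 0 < m) (ht : t ∈ Set.Icc t₀ T) (y : Fin n → ℝ) (η : ℕ → Ω → ℝ) (ω : Ω) :
    ∫ s in t₀..t, partialSum μb γ ψ (firstVec η m ω) s * Real.exp (-intPartialSum t₀ μa ν φ y s)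
      = etaScale t₀ μa ν γ φ ψ t y * η 0 ω
        + discountedTail t₀ μa μb ν γ φ ψ t (y, firstVec (dropFirst η) (m - 1) ω) := by
  have hT := ht.1.trans ht.2
  have hu := continuousOn_intPartialSum (ν := ν) hT h.mean_a h.eigen_a y
  have hl : t₀ ∈ Set.Icc t₀ T := ⟨le_rfl, hT⟩
  have h1 := intervalIntegrable_of_integrableOn_Icc
    (integrableOn_mul_exp (h.eigen_b ⟨0, hm⟩) hu) hl ht
  have h2 : IntervalIntegrable (fun s => partialSum μb (dropFirst γ) (dropFirst ψ)
      (firstVec (dropFirst η) (m - 1) ω) s * Real.exp (-intPartialSum t₀ μa ν φ y s)) volume t₀ t :=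
    intervalIntegrable_of_integrableOn_Icc (integrableOn_mul_exp
      (integrableOn_partialSum h.mean_b (fun i => h.eigen_b ⟨i + 1, by omega⟩) _) hu) hl ht
  rw [etaScale, discountedTail, mul_right_comm, ← intervalIntegral.integral_const_mul,
    ← intervalIntegral.integral_add (h1.const_mul _) h2]
  refine intervalIntegral.integral_congr fun s _ => ?_
  simp only [partialSum_firstVec hm]
  ring

/-- The truncated solution as an affine function of the first random coefficient of `b`. -/
theorem IntegrableCoeffs.linearSolution_firstVec (h : IntegrableCoeffs t₀ T μa μb φ ψ n m)
    (hm : 0 < m) (ht : t ∈ Set.Icc t₀ T) (z : ℝ) (y : Fin n → ℝ) (η : ℕ → Ω → ℝ) (ω : Ω) :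
    linearSolution t₀ z (partialSum μa ν φ y) (partialSum μb γ ψ (firstVec η m ω)) t
      = Real.exp (intPartialSum t₀ μa ν φ y t) * (z + (etaScale t₀ μa ν γ φ ψ t y * η 0 ω
        + discountedTail t₀ μa μb ν γ φ ψ t (y, firstVec (dropFirst η) (m - 1) ω))) := by
  rw [linearSolution_eq ht.1 ((integrableOn_partialSum h.mean_a h.eigen_a y).mono_set
    (Set.Icc_subset_Icc_right ht.2)), ← h.integral_partialSum_firstVec hm ht]
  rfl

/-- The approximating density as an expectation over all random coefficients but the first one
of `b`. -/
theorem IntegrableCoeffs.densityIsolatingEta_eq_integral [MeasurableSpace Ω] {P : Measure Ω}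
    [IsProbabilityMeasure P]
    (h : IntegrableCoeffs t₀ T μa μb φ ψ n m)
    (hm : 0 < m) (ht : t ∈ Set.Icc t₀ T) {x₀ : Ω → ℝ}
    {W : Ω → (Fin n → ℝ) × (Fin (m - 1) → ℝ)} {f₀ fη : ℝ → ℝ}
    {fv : (Fin n → ℝ) × (Fin (m - 1) → ℝ) → ℝ} (hx : IsDensity P x₀ f₀) (hW : IsDensity P W fv)
    (hind : IndepFun x₀ W P) (hη : Measurable fη)
    (hbox : ∀ᵐ ω ∂P, ∀ j, (W ω).1 j ∈ Set.Icc (-A) A) (x : ℝ) :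
    densityIsolatingEta t₀ A μa μb ν γ φ ψ n m f₀ fη fv t x
      = ∫ ω, fη ((x * Real.exp (-intPartialSum t₀ μa ν φ (W ω).1 t) - x₀ ω
          - discountedTail t₀ μa μb ν γ φ ψ t (W ω)) / etaScale t₀ μa ν γ φ ψ t (W ω).1)
        * (Real.exp (-intPartialSum t₀ μa ν φ (W ω).1 t)
          / etaScale t₀ μa ν γ φ ψ t (W ω).1) ∂P := by
  set G : ℝ × (Fin n → ℝ) × (Fin (m - 1) → ℝ) → ℝ := fun p =>
    fη ((x * Real.exp (-intPartialSum t₀ μa ν φ p.2.1 t) - p.1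
          - discountedTail t₀ μa μb ν γ φ ψ t p.2) / etaScale t₀ μa ν γ φ ψ t p.2.1)
        * (Real.exp (-intPartialSum t₀ μa ν φ p.2.1 t) / etaScale t₀ μa ν γ φ ψ t p.2.1) with hG
  set D : Set (ℝ × (Fin n → ℝ) × (Fin (m - 1) → ℝ)) :=
    Set.univ ×ˢ ((Set.univ.pi fun _ => Set.Icc (-A) A) ×ˢ Set.univ) with hD
  have hDm : MeasurableSet D := MeasurableSet.univ.prod
    ((MeasurableSet.univ_pi fun _ => measurableSet_Icc).prod MeasurableSet.univ)
  have hGm : Measurable G := by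
    have h1 := (h.continuous_etaScale (ν := ν) (γ := γ) hm ht).measurable
    have h2 := (h.continuous_discountedTail (ν := ν) (γ := γ) ht).measurable
    have h3 := (continuous_intPartialSum (ν := ν) h.mean_a h.eigen_a ht).measurable
    have h4 : Measurable fun p : ℝ × (Fin n → ℝ) × (Fin (m - 1) → ℝ) =>
        intPartialSum t₀ μa ν φ p.2.1 t := h3.comp (by fun_prop)
    have h5 : Measurable fun p : ℝ × (Fin n → ℝ) × (Fin (m - 1) → ℝ) =>
        etaScale t₀ μa ν γ φ ψ t p.2.1 := h1.comp (by fun_prop)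
    have h6 : Measurable fun p : ℝ × (Fin n → ℝ) × (Fin (m - 1) → ℝ) =>
        discountedTail t₀ μa μb ν γ φ ψ t p.2 := h2.comp measurable_snd
    fun_prop
  have key := (hx.prodMk hW hind).integral_comp (hGm.indicator hDm)
  have hl : ∫ ω, D.indicator G (x₀ ω, W ω) ∂P = ∫ ω, G (x₀ ω, W ω) ∂P := by
    refine integral_congr_ae ?_
    filter_upwards [hbox] with ω hω
    refine Set.indicator_of_mem ?_ G
    exact ⟨trivial, fun j _ => hω j, trivial⟩
  rw [hl] at key
  refine Eq.trans ?_ key.symm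
  rw [densityIsolatingEta, ← integral_indicator hDm]
  refine integral_congr_ae (.of_forall fun p => ?_)
  by_cases hp : p ∈ D
  · simp only [Set.indicator_of_mem hp, hG, discountedTail, etaScale]
    ring
  · simp only [Set.indicator_of_notMem hp, zero_mul]

/-- By independence the law of `η 0` is unchanged when all other variables are fixed, and then the
truncated solution is an affine function of `η 0` with positive slope. -/
theorem IntegrableCoeffs.isDensity_densityIsolatingEta [MeasurableSpace Ω] {P : Measure Ω}
    [IsProbabilityMeasure P]
    (h : IntegrableCoeffs t₀ T μa μb φ ψ n m) (hm : 0 < m) (ht : t ∈ Set.Ioc t₀ T)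
    (hγ : 0 < γ 0) (hψ : ∀ s ∈ Set.Ioo t₀ T, 0 < ψ 0 s) {x₀ : Ω → ℝ} {ξ η : ℕ → Ω → ℝ}
    {f₀ fη : ℝ → ℝ} {fv : (Fin n → ℝ) × (Fin (m - 1) → ℝ) → ℝ} (hx : IsDensity P x₀ f₀)
    (hη : IsDensity P (η 0) fη)
    (hW : IsDensity P (fun ω => (firstVec ξ n ω, firstVec (dropFirst η) (m - 1) ω)) fv)
    (hind₁ : IndepFun x₀
      (fun ω => (η 0 ω, firstVec ξ n ω, firstVec (dropFirst η) (m - 1) ω)) P)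
    (hind₂ : IndepFun (η 0) (fun ω => (firstVec ξ n ω, firstVec (dropFirst η) (m - 1) ω)) P)
    (hbox : ∀ᵐ ω ∂P, ∀ j, firstVec ξ n ω j ∈ Set.Icc (-A) A) {M : ℝ}
    (hM : ∀ᵐ ω ∂P, ∀ u, fη u * (Real.exp (-intPartialSum t₀ μa ν φ (firstVec ξ n ω) t)
      / etaScale t₀ μa ν γ φ ψ t (firstVec ξ n ω)) ≤ M) :
    IsDensity P (fun ω => linearSolution t₀ (x₀ ω) (partialSum μa ν φ (firstVec ξ n ω))
        (partialSum μb γ ψ (firstVec η m ω)) t)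
      (densityIsolatingEta t₀ A μa μb ν γ φ ψ n m f₀ fη fv t) := by
  have ht' : t ∈ Set.Icc t₀ T := ⟨ht.1.le, ht.2⟩
  set W : Ω → (Fin n → ℝ) × (Fin (m - 1) → ℝ) :=
    fun ω => (firstVec ξ n ω, firstVec (dropFirst η) (m - 1) ω) with hWdef
  have hxW : IndepFun x₀ W P := hind₁.comp measurable_id measurable_snd
  have hηU : IndepFun (η 0) (fun ω => (x₀ ω, W ω)) P :=
    hind₁.prodMk_left_comm hx.aemeasurable hη.aemeasurable hW.aemeasurable hind₂
  let c : ℝ × (Fin n → ℝ) × (Fin (m - 1) → ℝ) → ℝ := fun p =>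
    Real.exp (intPartialSum t₀ μa ν φ p.2.1 t) * etaScale t₀ μa ν γ φ ψ t p.2.1
  let d : ℝ × (Fin n → ℝ) × (Fin (m - 1) → ℝ) → ℝ := fun p =>
    Real.exp (intPartialSum t₀ μa ν φ p.2.1 t)
      * (p.1 + discountedTail t₀ μa μb ν γ φ ψ t p.2)
  have h1 := (h.continuous_etaScale (ν := ν) (γ := γ) hm ht').measurable
  have h2 := (h.continuous_discountedTail (ν := ν) (γ := γ) ht').measurable
  have h3 := (continuous_intPartialSum (ν := ν) h.mean_a h.eigen_a ht').measurable
  have h4 : Measurable fun p : ℝ × (Fin n → ℝ) × (Fin (m - 1) → ℝ) =>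
      intPartialSum t₀ μa ν φ p.2.1 t := h3.comp (by fun_prop)
  have h5 : Measurable fun p : ℝ × (Fin n → ℝ) × (Fin (m - 1) → ℝ) =>
      etaScale t₀ μa ν γ φ ψ t p.2.1 := h1.comp (by fun_prop)
  have h6 : Measurable fun p : ℝ × (Fin n → ℝ) × (Fin (m - 1) → ℝ) =>
      discountedTail t₀ μa μb ν γ φ ψ t p.2 := h2.comp measurable_snd
  have hc0 : ∀ p, 0 < c p := fun p =>
    mul_pos (Real.exp_pos _) (h.etaScale_pos hm ht hγ hψ _)
  have key := hη.affine_of_indep (hx.aemeasurable.prodMk hW.aemeasurable) hηU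
    (c := c) (d := d) (by fun_prop) (by fun_prop) hc0 (M := M) (by
      filter_upwards [hM] with ω hω u
      refine le_of_eq_of_le ?_ (hω u)
      simp only [c, hWdef, Real.exp_neg]
      field_simp)
  convert key using 1
  · ext ω
    rw [h.linearSolution_firstVec hm ht']
    simp only [c, d, hWdef]
    ring
  · ext x
    rw [h.densityIsolatingEta_eq_integral hm ht' hx hW hxW hη.measurable hbox]
    refine integral_congr_ae (.of_forall fun ω => ?_)
    have := h.etaScale_pos (ν := ν) hm ht hγ hψ (W ω).1
    have he : (x * Real.exp (-intPartialSum t₀ μa ν φ (W ω).1 t) - x₀ ω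
        - discountedTail t₀ μa μb ν γ φ ψ t (W ω)) / etaScale t₀ μa ν γ φ ψ t (W ω).1
        = (x - d (x₀ ω, W ω)) / c (x₀ ω, W ω) := by
      simp only [c, d, Real.exp_neg]
      field_simp
      ring
    simp only
    rw [he, div_eq_mul_inv (fη _)]
    congr 1
    simp only [c, Real.exp_neg]
    field_simp

/-- The formulas isolating the first random coefficient of `b` and isolating `x₀` agree: they
are two ways to write the same convolution. -/
theorem IntegrableCoeffs.densityIsolatingEta_eq_densityIsolatingInit [MeasurableSpace Ω] {P : Measure Ω}
    [IsProbabilityMeasure P]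
    (h : IntegrableCoeffs t₀ T μa μb φ ψ n m) (hm : 0 < m) (ht : t ∈ Set.Ioc t₀ T)
    (hγ : 0 < γ 0) (hψ : ∀ s ∈ Set.Ioo t₀ T, 0 < ψ 0 s) {x₀ : Ω → ℝ} {ξ η : ℕ → Ω → ℝ}
    {f₀ fη : ℝ → ℝ} {fv : (Fin n → ℝ) × (Fin (m - 1) → ℝ) → ℝ} (hx : IsDensity P x₀ f₀)
    (hη : IsDensity P (η 0) fη)
    (hW : IsDensity P (fun ω => (firstVec ξ n ω, firstVec (dropFirst η) (m - 1) ω)) fv)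
    (hind₁ : IndepFun x₀ (fun ω => (firstVec ξ n ω, firstVec (dropFirst η) (m - 1) ω)) P)
    (hind₂ : IndepFun (η 0) (fun ω => (firstVec ξ n ω, firstVec (dropFirst η) (m - 1) ω)) P)
    (hbox : ∀ᵐ ω ∂P, ∀ j, firstVec ξ n ω j ∈ Set.Icc (-A) A)
    {g : (Fin n → ℝ) × (Fin m → ℝ) → ℝ}
    (hg : IsDensity P (fun ω => (firstVec ξ n ω, firstVec η m ω)) g) (x : ℝ) :
    densityIsolatingEta t₀ A μa μb ν γ φ ψ n m f₀ fη fv t x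
      = densityIsolatingInit t₀ μa μb ν γ φ ψ n m f₀ g t x := by
  have ht' : t ∈ Set.Icc t₀ T := ⟨ht.1.le, ht.2⟩
  set W : Ω → (Fin n → ℝ) × (Fin (m - 1) → ℝ) :=
    fun ω => (firstVec ξ n ω, firstVec (dropFirst η) (m - 1) ω) with hWdef
  have h1 := (h.continuous_etaScale (ν := ν) (γ := γ) hm ht').measurable
  have h2 := (h.continuous_discountedTail (ν := ν) (γ := γ) ht').measurable
  have h3 := (continuous_intPartialSum (ν := ν) h.mean_a h.eigen_a ht').measurable
  have h4 : Measurable fun w : (Fin n → ℝ) × (Fin (m - 1) → ℝ) =>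
      intPartialSum t₀ μa ν φ w.1 t := h3.comp measurable_fst
  have h5 : Measurable fun w : (Fin n → ℝ) × (Fin (m - 1) → ℝ) =>
      etaScale t₀ μa ν γ φ ψ t w.1 := h1.comp measurable_fst
  have hf := hx.measurable
  have hfη := hη.measurable
  rw [h.densityIsolatingEta_eq_integral hm ht' hx hW hind₁ hη.measurable hbox]
  have hinit : densityIsolatingInit t₀ μa μb ν γ φ ψ n m f₀ g t x
      = ∫ ω, f₀ (x * Real.exp (-intPartialSum t₀ μa ν φ (W ω).1 t)
          - discountedTail t₀ μa μb ν γ φ ψ t (W ω)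
          - etaScale t₀ μa ν γ φ ψ t (W ω).1 * η 0 ω)
        * Real.exp (-intPartialSum t₀ μa ν φ (W ω).1 t) ∂P := by
    have h7 : Measurable fun p : (Fin n → ℝ) × (Fin m → ℝ) =>
        intPartialSum t₀ μa ν φ p.1 t := h3.comp measurable_fst
    have h8 := (continuous_integral_partialSum_mul_exp (ν := ν) (γ := γ) ht' h.mean_a h.eigen_a
      h.mean_b h.eigen_b).measurable
    have hG : Measurable fun p : (Fin n → ℝ) × (Fin m → ℝ) =>
        f₀ (x * Real.exp (-intPartialSum t₀ μa ν φ p.1 t)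
          - ∫ s in t₀..t, partialSum μb γ ψ p.2 s * Real.exp (-intPartialSum t₀ μa ν φ p.1 s))
        * Real.exp (-intPartialSum t₀ μa ν φ p.1 t) := by fun_prop
    have key := hg.integral_comp hG
    rw [densityIsolatingInit]
    simp only [mul_right_comm _ (g _)]
    rw [← key]
    refine integral_congr_ae (.of_forall fun ω => ?_)
    simp only
    rw [h.integral_partialSum_firstVec hm ht', sub_sub, add_comm (discountedTail _ _ _ _ _ _ _ _ _)]
  rw [hinit]
  have hs0 : ∀ w : (Fin n → ℝ) × (Fin (m - 1) → ℝ), 0 < etaScale t₀ μa ν γ φ ψ t w.1 :=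
    fun w => h.etaScale_pos hm ht hγ hψ _
  have hW' := hW.aemeasurable
  have hη' := hη.aemeasurable
  have hx' := hx.aemeasurable
  have h4W := h4.comp_aemeasurable hW'
  have h5W := h5.comp_aemeasurable hW'
  have h2W := h2.comp_aemeasurable hW'
  simp only [Function.comp_def] at h4W h5W h2W
  rw [integral_eq_lintegral_of_nonneg_ae, integral_eq_lintegral_of_nonneg_ae]
  · congr 1
    have key := hx.lintegral_convolution_comm hη hW.aemeasurable hind₁ hind₂
      (q := fun w => x * Real.exp (-intPartialSum t₀ μa ν φ w.1 t)
        - discountedTail t₀ μa μb ν γ φ ψ t w)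
      (s := fun w => etaScale t₀ μa ν γ φ ψ t w.1)
      (h := fun w => Real.exp (-intPartialSum t₀ μa ν φ w.1 t))
      (by fun_prop) h5 (by fun_prop) hs0
    simp only [sub_right_comm _ (discountedTail _ _ _ _ _ _ _ _ _) (x₀ _)] at key
    exact key
  · exact .of_forall fun ω => mul_nonneg (hx.nonneg _) (Real.exp_pos _).le
  · exact ((hf.comp_aemeasurable (by fun_prop)).mul (by fun_prop)).aestronglyMeasurable
  · exact .of_forall fun ω =>
      mul_nonneg (hη.nonneg _) (div_nonneg (Real.exp_pos _).le (hs0 _).le)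
  · exact ((hfη.comp_aemeasurable (by fun_prop)).mul (by fun_prop)).aestronglyMeasurable

end Truncated

/-! ### Locally uniform convergence of equi-Lipschitz densities -/

/-- Equi-Lipschitz functions that converge pointwise converge uniformly on compact sets. -/
theorem tendstoUniformlyOn_of_lipschitzWith {D : ℕ → ℝ → ℝ} {f : ℝ → ℝ} {L : NNReal}
    (hL : ∀ N, LipschitzWith L (D N)) (hf : LipschitzWith L f)
    (hlim : ∀ x, Tendsto (fun N => D N x) atTop (𝓝 (f x))) {K : Set ℝ} (hK : IsCompact K) :
    TendstoUniformlyOn D f atTop K := by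
  rw [Metric.tendstoUniformlyOn_iff]
  intro ε hε
  have hδ : 0 < ε / (3 * (L + 1)) := by positivity
  obtain ⟨F, -, hF, hcov⟩ := hK.finite_cover_balls hδ
  have hev : ∀ᶠ N in atTop, ∀ x ∈ F, dist (D N x) (f x) < ε / 3 :=
    (eventually_all_finite hF).2 fun x _ =>
      (Metric.tendsto_nhds.1 (hlim x)) _ (by positivity)
  filter_upwards [hev] with N hN y hy
  obtain ⟨x, hx, hyx⟩ := Set.mem_iUnion₂.1 (hcov hy)
  have hLd : (L : ℝ) * dist y x ≤ ε / 3 := by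
    calc (L : ℝ) * dist y x ≤ (L + 1) * (ε / (3 * (L + 1))) :=
          mul_le_mul (by linarith) (Metric.mem_ball.1 hyx).le dist_nonneg (by positivity)
      _ = ε / 3 := by field_simp
  have h1 := (hf.dist_le_mul y x).trans hLd
  have h2 := ((hL N).dist_le_mul y x).trans hLd
  have h3 := hN x hx
  rw [dist_comm] at h2 h3
  have h4 := dist_triangle4 (f y) (f x) (D N x) (D N y)
  linarith

/-- Let `X N → X` almost surely, where the `X N` have uniformly bounded and equi-Lipschitz
densities `D N` that converge pointwise to `f`. Then `f` is a density of `X`, and the convergence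
holds in `L^∞` of bounded sets. -/
theorem isDensity_of_tendsto {Ω : Type*} [MeasurableSpace Ω] {P : Measure Ω}
    [IsProbabilityMeasure P] {X : ℕ → Ω → ℝ} {Y : Ω → ℝ} {D : ℕ → ℝ → ℝ} {f : ℝ → ℝ} {L : NNReal}
    {M : ℝ} (hD : ∀ N, IsDensity P (X N) (D N))
    (hX : ∀ᵐ ω ∂P, Tendsto (fun N => X N ω) atTop (𝓝 (Y ω)))
    (hL : ∀ N, LipschitzWith L (D N)) (hM : ∀ N x, D N x ≤ M)
    (hlim : ∀ x, Tendsto (fun N => D N x) atTop (𝓝 (f x))) :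
    IsDensity P Y f ∧ ∀ J : Set ℝ, Bornology.IsBounded J →
      MemLp f ∞ (volume.restrict J) ∧ (∀ N, MemLp (D N) ∞ (volume.restrict J)) ∧
      Tendsto (fun N => eLpNorm (D N - f) ∞ (volume.restrict J)) atTop (𝓝 0) := by
  have hfL : LipschitzWith L f := LipschitzWith.of_dist_le_mul fun x y =>
    le_of_tendsto ((hlim x).dist (hlim y)) (.of_forall fun N => (hL N).dist_le_mul x y)
  have hf0 : ∀ x, 0 ≤ f x := fun x => ge_of_tendsto' (hlim x) fun N => (hD N).nonneg x
  have hfM : ∀ x, f x ≤ M := fun x => le_of_tendsto' (hlim x) fun N => hM N x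
  have hY : AEMeasurable Y P :=
    aemeasurable_of_tendsto_metrizable_ae atTop (fun N => (hD N).aemeasurable) hX
  refine ⟨⟨hY, hfL.continuous.measurable, hf0, ?_⟩, fun J hJ => ⟨?_, fun N => ?_, ?_⟩⟩
  · have := Measure.isProbabilityMeasure_map hY
    have : IsLocallyFiniteMeasure (volume.withDensity fun x => ENNReal.ofReal (f x)) :=
      IsLocallyFiniteMeasure.withDensity_ofReal hfL.continuous
    refine Measure.ext_of_integral_eq_on_compactlySupported fun g => ?_
    have hg : Continuous g := g.continuous
    obtain ⟨B, hB⟩ := g.hasCompactSupport.exists_bound_of_continuous hg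
    have e1 : Tendsto (fun N => ∫ ω, g (X N ω) ∂P) atTop (𝓝 (∫ ω, g (Y ω) ∂P)) := by
      refine tendsto_integral_of_dominated_convergence (fun _ => B) (fun N => ?_)
        (integrable_const B) (fun N => .of_forall fun ω => hB _) ?_
      · exact (hg.measurable.comp_aemeasurable (hD N).aemeasurable).aestronglyMeasurable
      · filter_upwards [hX] with ω hω
        exact (hg.tendsto _).comp hω
    have e2 : Tendsto (fun N => ∫ x, g x * D N x) atTop (𝓝 (∫ x, g x * f x)) := by
      refine tendsto_integral_of_dominated_convergence (fun x => ‖g x‖ * M) (fun N => ?_)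
        ((hg.integrable_of_hasCompactSupport g.hasCompactSupport).norm.mul_const M)
        (fun N => .of_forall fun x => ?_) (.of_forall fun x => (hlim x).const_mul _)
      · exact (hg.mul (hL N).continuous).aestronglyMeasurable
      · rw [norm_mul, Real.norm_of_nonneg ((hD N).nonneg x)]
        exact mul_le_mul_of_nonneg_left (hM N x) (norm_nonneg _)
    simp only [fun N => (hD N).integral_comp hg.measurable] at e1
    rw [integral_map hY hg.aestronglyMeasurable, tendsto_nhds_unique e1 e2,
      integral_withDensity_eq_integral_toReal_smul hfL.continuous.measurable.ennreal_ofReal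
        (by simp)]
    refine integral_congr_ae (.of_forall fun x => ?_)
    simp [ENNReal.toReal_ofReal (hf0 x), mul_comm]
  · refine memLp_top_of_bound hfL.continuous.aestronglyMeasurable M (.of_forall fun x => ?_)
    rw [Real.norm_of_nonneg (hf0 x)]
    exact hfM x
  · refine memLp_top_of_bound (hL N).continuous.aestronglyMeasurable M (.of_forall fun x => ?_)
    rw [Real.norm_of_nonneg ((hD N).nonneg x)]
    exact hM N x
  · obtain ⟨r, hr⟩ := hJ.subset_closedBall 0
    have hu := tendstoUniformlyOn_of_lipschitzWith hL hfL hlim (isCompact_closedBall (0 : ℝ) r)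
    rw [Metric.tendstoUniformlyOn_iff] at hu
    rw [ENNReal.tendsto_nhds_zero]
    intro ε hε
    obtain ⟨δ, hδ0, hδ⟩ := ENNReal.lt_iff_exists_nnreal_btwn.1 hε
    filter_upwards [hu δ (by exact_mod_cast hδ0)] with N hN
    calc eLpNorm (D N - f) ∞ (volume.restrict J)
        ≤ eLpNorm (D N - f) ∞ (volume.restrict (Metric.closedBall 0 r)) :=
          eLpNorm_mono_measure _ (Measure.restrict_mono_set _ hr)
      _ ≤ δ := by
          rw [eLpNorm_exponent_top]
          refine eLpNormEssSup_le_of_ae_nnnorm_bound ?_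
          filter_upwards [ae_restrict_mem Metric.isClosed_closedBall.measurableSet] with x hx
          have := hN x hx
          rw [dist_comm, Real.dist_eq, ← Real.norm_eq_abs] at this
          exact_mod_cast this.le
      _ ≤ ε := hδ.le

/-! ### Stability of the solution formula -/

theorem tendsto_setIntegral_of_tendsto_L1 {f : ℕ → ℝ → ℝ} {g : ℝ → ℝ} {t₀ T s : ℝ}
    (hf : ∀ N, IntegrableOn (f N) (Set.Icc t₀ T)) (hg : IntegrableOn g (Set.Icc t₀ T))
    (hlim : Tendsto (fun N => ∫ r in Set.Icc t₀ T, |f N r - g r|) atTop (𝓝 0))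
    (hs : s ∈ Set.Icc t₀ T) :
    Tendsto (fun N => ∫ r in t₀..s, f N r) atTop (𝓝 (∫ r in t₀..s, g r)) := by
  have hl : t₀ ∈ Set.Icc t₀ T := ⟨le_rfl, hs.1.trans hs.2⟩
  rw [tendsto_iff_norm_sub_tendsto_zero]
  refine squeeze_zero (fun N => norm_nonneg _) (fun N => ?_) hlim
  rw [← intervalIntegral.integral_sub (intervalIntegrable_of_integrableOn_Icc (hf N) hl hs)
    (intervalIntegrable_of_integrableOn_Icc hg hl hs), intervalIntegral.integral_of_le hs.1]
  refine (norm_integral_le_integral_norm _).trans (setIntegral_mono_set ((hf N).sub hg).norm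
      (.of_forall fun _ => norm_nonneg _) ?_)
  exact (Set.Ioc_subset_Icc_self.trans (Set.Icc_subset_Icc_right hs.2)).eventuallyLE

/-- Continuity of `∫ b exp(-∫ a)` in `a` and `b` for the `L¹` norm. -/
theorem tendsto_integral_mul_exp {a b : ℕ → ℝ → ℝ} {a' b' : ℝ → ℝ} {t₀ T t : ℝ}
    (ha : ∀ N, IntegrableOn (a N) (Set.Icc t₀ T)) (ha' : IntegrableOn a' (Set.Icc t₀ T))
    (hb : ∀ N, IntegrableOn (b N) (Set.Icc t₀ T)) (hb' : IntegrableOn b' (Set.Icc t₀ T))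
    (halim : Tendsto (fun N => ∫ r in Set.Icc t₀ T, |a N r - a' r|) atTop (𝓝 0))
    (hblim : Tendsto (fun N => ∫ r in Set.Icc t₀ T, |b N r - b' r|) atTop (𝓝 0))
    (ht : t ∈ Set.Icc t₀ T) :
    Tendsto (fun N => ∫ s in t₀..t, b N s * Real.exp (-∫ r in t₀..s, a N r)) atTop
      (𝓝 (∫ s in t₀..t, b' s * Real.exp (-∫ r in t₀..s, a' r))) := by
  have hT : t₀ ≤ T := ht.1.trans ht.2
  have hl : t₀ ∈ Set.Icc t₀ T := ⟨le_rfl, hT⟩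
  have hsub : Set.uIoc t₀ t ⊆ Set.Icc t₀ T := by
    rw [Set.uIoc_of_le ht.1]
    exact Set.Ioc_subset_Icc_self.trans (Set.Icc_subset_Icc_right ht.2)
  have hsub' : Set.Ioc t₀ t ≤ᵐ[volume] Set.Icc t₀ T := by
    rw [← Set.uIoc_of_le ht.1]
    exact hsub.eventuallyLE
  set C := (∫ r in Set.Icc t₀ T, |a' r|) + 1
  have hC : ∀ᶠ N in atTop, ∀ s ∈ Set.Icc t₀ T, Real.exp (-∫ r in t₀..s, a N r) ≤ Real.exp C := by
    filter_upwards [halim.eventually_lt_const one_pos] with N hN s hs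
    refine Real.exp_le_exp.2 ((neg_le_abs _).trans ?_)
    rw [intervalIntegral.integral_of_le hs.1]
    calc |∫ r in Set.Ioc t₀ s, a N r| ≤ ∫ r in Set.Ioc t₀ s, |a N r| := abs_integral_le_integral_abs
      _ ≤ ∫ r in Set.Icc t₀ T, |a N r| :=
        setIntegral_mono_set (ha N).abs (.of_forall fun _ => abs_nonneg _)
          (Set.Ioc_subset_Icc_self.trans (Set.Icc_subset_Icc_right hs.2)).eventuallyLE
      _ ≤ ∫ r in Set.Icc t₀ T, (|a' r| + |a N r - a' r|) := by
        refine integral_mono (ha N).abs (ha'.abs.add ((ha N).sub ha').abs) fun r => ?_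
        have := abs_add_le (a' r) (a N r - a' r)
        rwa [add_sub_cancel] at this
      _ = (∫ r in Set.Icc t₀ T, |a' r|) + ∫ r in Set.Icc t₀ T, |a N r - a' r| :=
        integral_add ha'.abs ((ha N).sub ha').abs
      _ ≤ C := by simp only [C]; linarith
  have hexp : ∀ {h : ℝ → ℝ}, IntegrableOn h (Set.Icc t₀ T) → ∀ N,
      IntegrableOn (fun s => h s * Real.exp (-∫ r in t₀..s, a N r)) (Set.Icc t₀ T) :=
    fun hh N => integrableOn_mul_exp hh (continuousOn_integral_Icc hT (ha N))
  have h1 : Tendsto (fun N => ∫ s in t₀..t, (b N s - b' s) * Real.exp (-∫ r in t₀..s, a N r))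
      atTop (𝓝 0) := by
    refine squeeze_zero_norm' ?_ (by simpa using hblim.mul_const (Real.exp C))
    filter_upwards [hC] with N hN
    rw [intervalIntegral.integral_of_le ht.1, ← integral_mul_const]
    have hi : IntegrableOn (fun s => |b N s - b' s| * Real.exp C) (Set.Icc t₀ T) :=
      ((hb N).sub hb').abs.mul_const _
    calc ‖∫ s in Set.Ioc t₀ t, (b N s - b' s) * Real.exp (-∫ r in t₀..s, a N r)‖
        ≤ ∫ s in Set.Ioc t₀ t, ‖(b N s - b' s) * Real.exp (-∫ r in t₀..s, a N r)‖ :=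
          norm_integral_le_integral_norm _
      _ ≤ ∫ s in Set.Icc t₀ T, ‖(b N s - b' s) * Real.exp (-∫ r in t₀..s, a N r)‖ :=
          setIntegral_mono_set (hexp ((hb N).sub hb') N).norm (.of_forall fun _ => norm_nonneg _)
            hsub'
      _ ≤ ∫ s in Set.Icc t₀ T, |b N s - b' s| * Real.exp C := by
          refine setIntegral_mono_on (hexp ((hb N).sub hb') N).norm hi measurableSet_Icc
            fun s hs => ?_
          rw [Real.norm_eq_abs, abs_mul, Real.abs_exp]
          exact mul_le_mul_of_nonneg_left (hN s hs) (abs_nonneg _)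
  have h2 : Tendsto (fun N => ∫ s in t₀..t, b' s * Real.exp (-∫ r in t₀..s, a N r))
      atTop (𝓝 (∫ s in t₀..t, b' s * Real.exp (-∫ r in t₀..s, a' r))) := by
    refine intervalIntegral.tendsto_integral_filter_of_dominated_convergence
      (fun s => |b' s| * Real.exp C) ?_ ?_ ?_ ?_
    · exact .of_forall fun N => ((hexp hb' N).mono_set hsub).1
    · filter_upwards [hC] with N hN
      refine .of_forall fun s hs => ?_
      rw [Real.norm_eq_abs, abs_mul, Real.abs_exp]
      exact mul_le_mul_of_nonneg_left (hN s (hsub hs)) (abs_nonneg _)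
    · exact (intervalIntegrable_of_integrableOn_Icc hb' hl ht).abs.mul_const _
    · refine .of_forall fun s hs => ?_
      exact (((Real.continuous_exp.tendsto _).comp
        (tendsto_setIntegral_of_tendsto_L1 ha ha' halim (hsub hs)).neg)).const_mul _
  have h3 := h1.add h2
  rw [zero_add] at h3
  refine h3.congr fun N => ?_
  have hi : IntervalIntegrable (fun s => (b N s - b' s) * Real.exp (-∫ r in t₀..s, a N r))
      volume t₀ t := intervalIntegrable_of_integrableOn_Icc (hexp ((hb N).sub hb') N) hl ht
  rw [← intervalIntegral.integral_add hi
    (intervalIntegrable_of_integrableOn_Icc (hexp hb' N) hl ht)]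
  refine intervalIntegral.integral_congr fun s _ => ?_
  ring

/-! ### Uniform estimates and the limit -/

section Limit

variable {Ω : Type*} {t₀ T t A : ℝ} {μa μb : ℝ → ℝ} {ν γ : ℕ → ℝ} {φ ψ : ℕ → ℝ → ℝ} {n m : ℕ}

theorem IntegrableCoeffs.exp_div_etaScale_le (h : IntegrableCoeffs t₀ T μa μb φ ψ n m)
    (hm : 0 < m) (ht : t ∈ Set.Ioc t₀ T) (hγ : 0 < γ 0) (hψ : ∀ s ∈ Set.Ioo t₀ T, 0 < ψ 0 s)
    {C : ℝ} {y : Fin n → ℝ} (hC : ∀ s ∈ Set.Icc t₀ T, |intPartialSum t₀ μa ν φ y s| ≤ C) :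
    Real.exp (-intPartialSum t₀ μa ν φ y t) / etaScale t₀ μa ν γ φ ψ t y
      ≤ Real.exp C / (Real.sqrt (γ 0) * ∫ s in t₀..t, ψ 0 s * Real.exp (-C)) := by
  have hT : t₀ ≤ T := ht.1.le.trans ht.2
  have ht' : t ∈ Set.Icc t₀ T := ⟨ht.1.le, ht.2⟩
  have hl : t₀ ∈ Set.Icc t₀ T := ⟨le_rfl, hT⟩
  have hψ0 := h.eigen_b ⟨0, hm⟩
  have hu := continuousOn_intPartialSum (ν := ν) hT h.mean_a h.eigen_a y
  have hpos := integral_mul_exp_pos (u := fun _ => C) ht hψ0 hψ continuousOn_const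
  have hsq := Real.sqrt_pos.2 hγ
  refine div_le_div₀ (Real.exp_pos _).le
    (Real.exp_le_exp.2 ((neg_le_abs _).trans (hC t ht'))) (mul_pos hsq hpos) ?_
  refine mul_le_mul_of_nonneg_left ?_ hsq.le
  refine intervalIntegral.integral_mono_on_of_le_Ioo ht.1.le
    (intervalIntegrable_of_integrableOn_Icc (integrableOn_mul_exp hψ0 continuousOn_const) hl ht')
    (intervalIntegrable_of_integrableOn_Icc (integrableOn_mul_exp hψ0 hu) hl ht') fun s hs => ?_
  have hs' : s ∈ Set.Icc t₀ T := ⟨hs.1.le, hs.2.le.trans ht.2⟩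
  exact mul_le_mul_of_nonneg_left
    (Real.exp_le_exp.2 (neg_le_neg ((le_abs_self _).trans (hC s hs'))))
    (hψ s ⟨hs.1, hs.2.trans_le ht.2⟩).le

/-- Measurability in `ω` of the random variable whose expectation is the approximating density. -/
theorem IntegrableCoeffs.aestronglyMeasurable_integrand [MeasurableSpace Ω] {P : Measure Ω}
    (h : IntegrableCoeffs t₀ T μa μb φ ψ n m) (hm : 0 < m) (ht : t ∈ Set.Icc t₀ T)
    {x₀ : Ω → ℝ} {W : Ω → (Fin n → ℝ) × (Fin (m - 1) → ℝ)} {fη : ℝ → ℝ} (hx : AEMeasurable x₀ P)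
    (hW : AEMeasurable W P) (hη : Measurable fη) (x : ℝ) :
    AEStronglyMeasurable (fun ω => fη ((x * Real.exp (-intPartialSum t₀ μa ν φ (W ω).1 t) - x₀ ω
          - discountedTail t₀ μa μb ν γ φ ψ t (W ω)) / etaScale t₀ μa ν γ φ ψ t (W ω).1)
        * (Real.exp (-intPartialSum t₀ μa ν φ (W ω).1 t)
          / etaScale t₀ μa ν γ φ ψ t (W ω).1)) P := by
  have h1 := (h.continuous_etaScale (ν := ν) (γ := γ) hm ht).measurable.comp_aemeasurable hW.fst
  have h2 := (h.continuous_discountedTail (ν := ν) (γ := γ) ht).measurable.comp_aemeasurable hW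
  have h3 := (continuous_intPartialSum (ν := ν) h.mean_a h.eigen_a
    ht).measurable.comp_aemeasurable hW.fst
  simp only [Function.comp_def] at h1 h2 h3
  exact ((hη.comp_aemeasurable (by fun_prop)).mul (by fun_prop)).aestronglyMeasurable

/-- Uniform Lipschitz and sup bounds of the approximating density, from bounds of `fη` and of the
factor by which it is rescaled. -/
theorem IntegrableCoeffs.lipschitzWith_densityIsolatingEta [MeasurableSpace Ω] {P : Measure Ω}
    [IsProbabilityMeasure P] (h : IntegrableCoeffs t₀ T μa μb φ ψ n m) (hm : 0 < m)
    (ht : t ∈ Set.Ioc t₀ T) (hγ : 0 < γ 0) (hψ : ∀ s ∈ Set.Ioo t₀ T, 0 < ψ 0 s) {x₀ : Ω → ℝ}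
    {W : Ω → (Fin n → ℝ) × (Fin (m - 1) → ℝ)} {f₀ fη : ℝ → ℝ}
    {fv : (Fin n → ℝ) × (Fin (m - 1) → ℝ) → ℝ} (hx : IsDensity P x₀ f₀) (hW : IsDensity P W fv)
    (hind : IndepFun x₀ W P) {L M : NNReal} {B : ℝ} (hη : LipschitzWith L fη)
    (hη0 : ∀ u, 0 ≤ fη u) (hB : ∀ u, fη u ≤ B)
    (hbox : ∀ᵐ ω ∂P, ∀ j, (W ω).1 j ∈ Set.Icc (-A) A)
    (hM : ∀ᵐ ω ∂P, Real.exp (-intPartialSum t₀ μa ν φ (W ω).1 t)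
      / etaScale t₀ μa ν γ φ ψ t (W ω).1 ≤ M) :
    LipschitzWith (L * M ^ 2) (densityIsolatingEta t₀ A μa μb ν γ φ ψ n m f₀ fη fv t) ∧
      ∀ x, densityIsolatingEta t₀ A μa μb ν γ φ ψ n m f₀ fη fv t x ≤ B * M := by
  have ht' : t ∈ Set.Icc t₀ T := ⟨ht.1.le, ht.2⟩
  have hB0 : 0 ≤ B := (hη0 0).trans (hB 0)
  have hc : ∀ ω, 0 ≤ Real.exp (-intPartialSum t₀ μa ν φ (W ω).1 t)
      / etaScale t₀ μa ν γ φ ψ t (W ω).1 := fun ω =>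
    div_nonneg (Real.exp_pos _).le (h.etaScale_pos hm ht hγ hψ _).le
  have hmeas := h.aestronglyMeasurable_integrand (μb := μb) (ν := ν) (γ := γ) hm ht'
    hx.aemeasurable hW.aemeasurable hη.continuous.measurable
  have hbd : ∀ x, ∀ᵐ ω ∂P, ‖fη ((x * Real.exp (-intPartialSum t₀ μa ν φ (W ω).1 t) - x₀ ω
          - discountedTail t₀ μa μb ν γ φ ψ t (W ω)) / etaScale t₀ μa ν γ φ ψ t (W ω).1)
        * (Real.exp (-intPartialSum t₀ μa ν φ (W ω).1 t)
          / etaScale t₀ μa ν γ φ ψ t (W ω).1)‖ ≤ B * M := fun x => by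
    filter_upwards [hM] with ω hω
    rw [Real.norm_of_nonneg (mul_nonneg (hη0 _) (hc ω))]
    exact mul_le_mul (hB _) hω (hc ω) hB0
  have hrep := h.densityIsolatingEta_eq_integral (ν := ν) (γ := γ) hm ht' hx hW hind
    hη.continuous.measurable hbox
  refine ⟨LipschitzWith.of_dist_le_mul fun x x' => ?_, fun x => ?_⟩
  · rw [dist_eq_norm, hrep, hrep, ← integral_sub (.of_bound (hmeas x) _ (hbd x))
      (.of_bound (hmeas x') _ (hbd x'))]
    refine (norm_integral_le_of_norm_le_const (C := (L * M ^ 2 : NNReal) * dist x x') ?_).trans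
      (by simp)
    filter_upwards [hM] with ω hω
    have hcω := hc ω
    rw [← sub_mul, norm_mul, Real.norm_of_nonneg hcω, ← dist_eq_norm]
    refine (mul_le_mul_of_nonneg_right (hη.dist_le_mul _ _) hcω).trans ?_
    rw [Real.dist_eq, ← sub_div, sub_sub_sub_cancel_right, sub_sub_sub_cancel_right, ← sub_mul,
      mul_div_assoc, abs_mul, abs_of_nonneg hcω, ← Real.dist_eq]
    push_cast
    have := mul_le_mul hω hω hcω M.coe_nonneg
    have h3 := mul_le_mul_of_nonneg_left this (mul_nonneg L.coe_nonneg (dist_nonneg (x := x) (y := x')))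
    linarith
  · rw [hrep]
    refine (le_abs_self _).trans ?_
    simpa using norm_integral_le_of_norm_le_const (hbd x)

end Limit

/-! ### Convergence of the approximating densities -/

theorem mainTheorem2 {Ω : Type*} [MeasurableSpace Ω] (P : Measure Ω) [IsProbabilityMeasure P]
    (t₀ T : ℝ) (hT : t₀ < T)
    -- H1: the data
    (a b : ℝ → Ω → ℝ) (x₀ : Ω → ℝ)
    (ha : MemLp (Function.uncurry a) 2 ((volume.restrict (Set.Icc t₀ T)).prod P))
    (hb : MemLp (Function.uncurry b) 2 ((volume.restrict (Set.Icc t₀ T)).prod P))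
    (hx₀ : MemLp x₀ 2 P)
    -- the Karhunen-Loève expansions; index `0` is the first term, and `b` has a random part
    (Ja Jb : ℕ∞) (ν γ : ℕ → ℝ) (φ ψ : ℕ → ℝ → ℝ) (ξ η : ℕ → Ω → ℝ)
    (hKLa : IsKarhunenLoeve P t₀ T a Ja ν φ ξ)
    (hKLb : IsKarhunenLoeve P t₀ T b Jb γ ψ η)
    (hJb : 1 ≤ Jb) (hγ : 0 < γ 0)
    -- H2: absolute continuity and mutual independence
    (f₀ fη : ℝ → ℝ)
    (fv : (N : ℕ) → (Fin (truncLen Ja N) → ℝ) × (Fin (truncLen Jb N - 1) → ℝ) → ℝ)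
    (hf₀ : IsDensity P x₀ f₀)
    (hfη : IsDensity P (η 0) fη)
    (hfv : ∀ N : ℕ, 1 ≤ N → IsDensity P
      (fun ω => (firstVec ξ (truncLen Ja N) ω, firstVec (dropFirst η) (truncLen Jb N - 1) ω)) (fv N))
    (hind₁ : ∀ N : ℕ, 1 ≤ N → IndepFun x₀
      (fun ω => (η 0 ω, firstVec ξ (truncLen Ja N) ω, firstVec (dropFirst η) (truncLen Jb N - 1) ω)) P)
    (hind₂ : ∀ N : ℕ, 1 ≤ N → IndepFun (η 0)
      (fun ω => (firstVec ξ (truncLen Ja N) ω, firstVec (dropFirst η) (truncLen Jb N - 1) ω)) P)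
    -- H3
    (hLip : ∃ L, LipschitzWith L fη)
    -- H4
    (A : ℝ) (hA : 0 < A)
    (hξ : ∀ j : ℕ, (j : ℕ∞) < Ja → ∀ᵐ ω ∂P, ξ j ω ∈ Set.Icc (-A) A)
    (hψ : ∀ s ∈ Set.Ioo t₀ T, 0 < ψ 0 s)
    (t : ℝ) (ht : t ∈ Set.Ioc t₀ T) :
    -- `f₁ᴺ(·, t)` is a density of the truncated solution `x_{N,N}(t)`, given by either formula
    (∀ N : ℕ, 1 ≤ N →
      IsDensity P
        (fun ω => linearSolution t₀ (x₀ ω)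
          (partialSum (meanFun P a) ν φ (firstVec ξ (truncLen Ja N) ω))
          (partialSum (meanFun P b) γ ψ (firstVec η (truncLen Jb N) ω)) t)
        (densityIsolatingEta t₀ A (meanFun P a) (meanFun P b) ν γ φ ψ
          (truncLen Ja N) (truncLen Jb N) f₀ fη (fv N) t) ∧
      ∀ g : (Fin (truncLen Ja N) → ℝ) × (Fin (truncLen Jb N) → ℝ) → ℝ,
        IsDensity P
          (fun ω => (firstVec ξ (truncLen Ja N) ω, firstVec η (truncLen Jb N) ω)) g →
        ∀ x : ℝ,
          densityIsolatingEta t₀ A (meanFun P a) (meanFun P b) ν γ φ ψ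
            (truncLen Ja N) (truncLen Jb N) f₀ fη (fv N) t x =
          densityIsolatingInit t₀ (meanFun P a) (meanFun P b) ν γ φ ψ
            (truncLen Ja N) (truncLen Jb N) f₀ g t x) ∧
    -- convergence in `L^∞(J)`, for every bounded `J`, to a density of the solution `x(t)`
    ∃ f₁ : ℝ → ℝ,
      IsDensity P
        (fun ω => linearSolution t₀ (x₀ ω) (fun s => a s ω) (fun s => b s ω) t) f₁ ∧
      ∀ J : Set ℝ, Bornology.IsBounded J →
        MemLp f₁ ∞ (volume.restrict J) ∧
        (∀ N : ℕ, 1 ≤ N → MemLp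
          (densityIsolatingEta t₀ A (meanFun P a) (meanFun P b) ν γ φ ψ
            (truncLen Ja N) (truncLen Jb N) f₀ fη (fv N) t) ∞ (volume.restrict J)) ∧
        Tendsto (fun N : ℕ => eLpNorm
          (densityIsolatingEta t₀ A (meanFun P a) (meanFun P b) ν γ φ ψ
            (truncLen Ja N) (truncLen Jb N) f₀ fη (fv N) t - f₁) ∞ (volume.restrict J))
          atTop (𝓝 0) := by
  have hT' : t₀ ≤ T := hT.le
  have ht' : t ∈ Set.Icc t₀ T := ⟨ht.1.le, ht.2⟩
  have hcoeff : ∀ N, IntegrableCoeffs t₀ T (meanFun P a) (meanFun P b) φ ψ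
      (truncLen Ja N) (truncLen Jb N) := fun N =>
    { mean_a := (memLp_meanFun ha).integrable one_le_two
      mean_b := (memLp_meanFun hb).integrable one_le_two
      eigen_a := fun j =>
        (hKLa.eigenfunction_memLp j (natCast_lt_of_lt_truncLen j.2)).integrable one_le_two
      eigen_b := fun i =>
        (hKLb.eigenfunction_memLp i (natCast_lt_of_lt_truncLen i.2)).integrable one_le_two }
  have hm : ∀ N, 1 ≤ N → 0 < truncLen Jb N := fun N hN => truncLen_pos hJb hN
  have hψ0 : IntegrableOn (ψ 0) (Set.Icc t₀ T) := (hcoeff 1).eigen_b ⟨0, hm 1 le_rfl⟩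
  obtain ⟨L, hL⟩ := hLip
  obtain ⟨B, hB⟩ := exists_bound_of_lipschitzWith_density hL hfη.lintegral_eq_one.le
  have hB0 : 0 ≤ B := (hfη.nonneg 0).trans (hB 0)
  obtain ⟨C, hC⟩ := hKLa.exists_bound_intPartialSum hT' ha hA.le
  have hξall : ∀ᵐ ω ∂P, ∀ j : {j : ℕ // (j : ℕ∞) < Ja}, ξ j ω ∈ Set.Icc (-A) A :=
    ae_all_iff.2 fun j => hξ j j.2
  have hbox : ∀ N, ∀ᵐ ω ∂P, ∀ j, firstVec ξ (truncLen Ja N) ω j ∈ Set.Icc (-A) A := fun N => by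
    filter_upwards [hξall] with ω hω j
    exact hω ⟨j, natCast_lt_of_lt_truncLen j.2⟩
  have hle : ∀ N, ((truncLen Ja N : ℕ) : ℕ∞) ≤ Ja := fun N => by
    rw [truncLen, ENat.natCast_toNat (ne_top_of_le_ne_top (ENat.natCast_ne_top N)
      (min_le_left _ _))]
    exact min_le_right _ _
  -- a bound, uniform in `N`, of the factor by which the density of `η 0` is rescaled
  obtain ⟨M, hM⟩ : ∃ M : NNReal, ∀ N, 1 ≤ N → ∀ᵐ ω ∂P,
      Real.exp (-intPartialSum t₀ (meanFun P a) ν φ (firstVec ξ (truncLen Ja N) ω) t)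
        / etaScale t₀ (meanFun P a) ν γ φ ψ t (firstVec ξ (truncLen Ja N) ω) ≤ M := by
    refine ⟨(Real.exp C / (Real.sqrt (γ 0) * ∫ s in t₀..t, ψ 0 s * Real.exp (-C))).toNNReal,
      fun N hN => ?_⟩
    filter_upwards [hbox N] with ω hω
    refine ((hcoeff N).exp_div_etaScale_le (hm N hN) ht hγ hψ fun s hs => ?_).trans
      (Real.le_coe_toNNReal _)
    exact hC _ (hle N) _ (fun j => abs_le.2 (hω j)) s hs
  have hdens : ∀ N, 1 ≤ N → IsDensity P
      (fun ω => linearSolution t₀ (x₀ ω)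
        (partialSum (meanFun P a) ν φ (firstVec ξ (truncLen Ja N) ω))
        (partialSum (meanFun P b) γ ψ (firstVec η (truncLen Jb N) ω)) t)
      (densityIsolatingEta t₀ A (meanFun P a) (meanFun P b) ν γ φ ψ
        (truncLen Ja N) (truncLen Jb N) f₀ fη (fv N) t) := fun N hN => by
    refine (hcoeff N).isDensity_densityIsolatingEta (hm N hN) ht hγ hψ hf₀ hfη (hfv N hN)
      (hind₁ N hN) (hind₂ N hN) (hbox N) (M := B * M) ?_
    filter_upwards [hM N hN] with ω hω u
    exact mul_le_mul (hB u) hω (div_nonneg (Real.exp_pos _).le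
      ((hcoeff N).etaScale_pos (hm N hN) ht hγ hψ _).le) hB0
  have hindW : ∀ N, 1 ≤ N → IndepFun x₀ (fun ω =>
      (firstVec ξ (truncLen Ja N) ω, firstVec (dropFirst η) (truncLen Jb N - 1) ω)) P :=
    fun N hN => (hind₁ N hN).comp measurable_id measurable_snd
  refine ⟨fun N hN => ⟨hdens N hN, fun g hg x => ?_⟩, ?_⟩
  · exact (hcoeff N).densityIsolatingEta_eq_densityIsolatingInit (hm N hN) ht hγ hψ hf₀ hfη
      (hfv N hN) (hindW N hN) (hind₂ N hN) (hbox N) hg x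
  have hest : ∀ N, 1 ≤ N → _ := fun N hN =>
    (hcoeff N).lipschitzWith_densityIsolatingEta (ν := ν) (γ := γ) (hm N hN) ht hγ hψ hf₀
      (hfv N hN) (hindW N hN) hL hfη.nonneg hB (hbox N) (hM N hN)
  -- convergence along almost every path of all quantities that enter the solution formula
  have hpath : ∀ᵐ ω ∂P, IntegrableOn (fun s => a s ω) (Set.Icc t₀ T) ∧
      Tendsto (fun N => intPartialSum t₀ (meanFun P a) ν φ (firstVec ξ (truncLen Ja N) ω) t) atTop
        (𝓝 (∫ s in t₀..t, a s ω)) ∧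
      Tendsto (fun N => etaScale t₀ (meanFun P a) ν γ φ ψ t (firstVec ξ (truncLen Ja N) ω)) atTop
        (𝓝 (Real.sqrt (γ 0) * ∫ s in t₀..t, ψ 0 s * Real.exp (-∫ r in t₀..s, a r ω))) ∧
      Tendsto (fun N => ∫ s in t₀..t,
        partialSum (meanFun P b) γ ψ (firstVec η (truncLen Jb N) ω) s
          * Real.exp (-intPartialSum t₀ (meanFun P a) ν φ (firstVec ξ (truncLen Ja N) ω) s)) atTop
        (𝓝 (∫ s in t₀..t, b s ω * Real.exp (-∫ r in t₀..s, a r ω))) := by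
    filter_upwards [hKLa.ae_tendsto_partialSum hT' ha, hKLb.ae_tendsto_partialSum hT' hb]
      with ω ⟨ha1, ha2⟩ ⟨hb1, hb2⟩
    have hai : ∀ N, IntegrableOn (partialSum (meanFun P a) ν φ (firstVec ξ (truncLen Ja N) ω))
        (Set.Icc t₀ T) := fun N =>
      integrableOn_partialSum (hcoeff N).mean_a (hcoeff N).eigen_a _
    have hbi : ∀ N, IntegrableOn (partialSum (meanFun P b) γ ψ (firstVec η (truncLen Jb N) ω))
        (Set.Icc t₀ T) := fun N =>
      integrableOn_partialSum (hcoeff N).mean_b (hcoeff N).eigen_b _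
    exact ⟨ha1, tendsto_setIntegral_of_tendsto_L1 hai ha1 ha2 ht',
      (tendsto_integral_mul_exp hai ha1 (fun _ => hψ0) hψ0 ha2 (by simp) ht').const_mul _,
      tendsto_integral_mul_exp hai ha1 hbi hb1 ha2 hb2 ht'⟩
  -- the truncation orders start from `1`
  have key := isDensity_of_tendsto (P := P) (L := L * M ^ 2) (M := B * M)
    (X := fun N ω => linearSolution t₀ (x₀ ω)
      (partialSum (meanFun P a) ν φ (firstVec ξ (truncLen Ja (N + 1)) ω))
      (partialSum (meanFun P b) γ ψ (firstVec η (truncLen Jb (N + 1)) ω)) t)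
    (Y := fun ω => linearSolution t₀ (x₀ ω) (fun s => a s ω) (fun s => b s ω) t)
    (D := fun N => densityIsolatingEta t₀ A (meanFun P a) (meanFun P b) ν γ φ ψ
      (truncLen Ja (N + 1)) (truncLen Jb (N + 1)) f₀ fη (fv (N + 1)) t)
    (f := fun x => ∫ ω, fη ((x * Real.exp (-∫ s in t₀..t, a s ω) - x₀ ω
        - ((∫ s in t₀..t, b s ω * Real.exp (-∫ r in t₀..s, a r ω))
          - Real.sqrt (γ 0) * (∫ s in t₀..t, ψ 0 s * Real.exp (-∫ r in t₀..s, a r ω)) * η 0 ω))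
        / (Real.sqrt (γ 0) * ∫ s in t₀..t, ψ 0 s * Real.exp (-∫ r in t₀..s, a r ω)))
      * (Real.exp (-∫ s in t₀..t, a s ω)
        / (Real.sqrt (γ 0) * ∫ s in t₀..t, ψ 0 s * Real.exp (-∫ r in t₀..s, a r ω))) ∂P)
    (fun N => hdens (N + 1) (by omega)) ?_ (fun N => (hest (N + 1) (by omega)).1)
    (fun N => (hest (N + 1) (by omega)).2) ?_
  · refine ⟨_, key.1, fun J hJ => ⟨(key.2 J hJ).1, fun N hN => ?_, ?_⟩⟩
    · obtain ⟨k, rfl⟩ : ∃ k, N = k + 1 := ⟨N - 1, by omega⟩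
      exact (key.2 J hJ).2.1 k
    · exact (tendsto_add_atTop_iff_nat 1).1 (key.2 J hJ).2.2
  · filter_upwards [hpath] with ω ⟨h1, h2, h3, h4⟩
    rw [linearSolution_eq ht'.1 (h1.mono_set (Set.Icc_subset_Icc_right ht'.2))]
    have hlim := (((Real.continuous_exp.tendsto _).comp h2).mul (h4.const_add (x₀ ω))).comp
      (tendsto_add_atTop_nat 1)
    refine hlim.congr fun N => ?_
    rw [linearSolution_eq ht'.1 ((integrableOn_partialSum (hcoeff (N + 1)).mean_a
      (hcoeff (N + 1)).eigen_a _).mono_set (Set.Icc_subset_Icc_right ht'.2))]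
    rfl
  · intro x
    simp only [fun N => (hcoeff (N + 1)).densityIsolatingEta_eq_integral (ν := ν) (γ := γ)
      (hm (N + 1) (by omega)) ht' hf₀ (hfv (N + 1) (by omega)) (hindW (N + 1) (by omega))
      hfη.measurable (hbox (N + 1)) x]
    refine tendsto_integral_of_dominated_convergence (fun _ => B * M) (fun N => ?_)
      (integrable_const _) (fun N => ?_) ?_
    · exact (hcoeff (N + 1)).aestronglyMeasurable_integrand (hm (N + 1) (by omega)) ht'
        hf₀.aemeasurable (hfv (N + 1) (by omega)).aemeasurable hfη.measurable x
    · filter_upwards [hM (N + 1) (by omega)] with ω hω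
      have hc := div_nonneg (Real.exp_pos (-intPartialSum t₀ (meanFun P a) ν φ
          (firstVec ξ (truncLen Ja (N + 1)) ω) t)).le
        ((hcoeff (N + 1)).etaScale_pos (ν := ν) (hm (N + 1) (by omega)) ht hγ hψ
          (firstVec ξ (truncLen Ja (N + 1)) ω)).le
      rw [Real.norm_of_nonneg (mul_nonneg (hfη.nonneg _) hc)]
      exact mul_le_mul (hB _) hω hc hB0
    · filter_upwards [hpath] with ω ⟨h1, h2, h3, h4⟩
      have hpos := mul_pos (Real.sqrt_pos.2 hγ)
        (integral_mul_exp_pos ht hψ0 hψ (continuousOn_integral_Icc hT' h1))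
      have hexp := (Real.continuous_exp.tendsto _).comp h2.neg
      have htail := h4.sub (h3.mul_const (η 0 ω))
      have hlim := (((hL.continuous.tendsto _).comp
        ((((hexp.const_mul x).sub_const (x₀ ω)).sub htail).div h3 hpos.ne')).mul
          (hexp.div h3 hpos.ne')).comp (tendsto_add_atTop_nat 1)
      refine hlim.congr fun N => ?_
      have hsplit := (hcoeff (N + 1)).integral_partialSum_firstVec (ν := ν) (γ := γ)
        (hm (N + 1) (by omega)) ht' (firstVec ξ (truncLen Ja (N + 1)) ω) η ω
      simp only [Function.comp, Pi.div_apply]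
      rw [hsplit, add_sub_cancel_left]
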